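/- **Setting.** Let $A=(A_1,\dots,A_n)$ be $n\ge 1$ points in $\mathbb{R}^d$ with the Euclidean norm (repetitions allowed), let $c:[n]\to[\ell]$ be a coloring, and let $k\ge 1$ be an integer. A set $S\subseteq[n]$ is *balanced* if every color in $[\ell]$ occurs equally often in $S$. A *fair $k$-clustering* is an $n\times d$ matrix $C$ with at most $k$ distinct rows (the row $C_i$ is the center to which $A_i$ is assigned) such that for every $j$ the cluster $\{i : C_i=C_j\}$ is balanced. Its cost is $\sum_i\|A_i-C_i\|_2$ for fair $k$-median, $\sum_i\|A_i-C_i\|_2^2$ for fair $k$-means, and $\max_i\|A_i-C_i\|_2$ for fair $k$-center. Algorithms are programs for a real RAM: a machine with integer and real memory cells and indirect addressing, in which memory accesses, assignments, comparisons, the operations $+,-,\times$ on integers and $+,-,\times,/,\sqrt{\cdot}$ on reals, and the conversion of an integer to a real each take one step. **Theorem (PTAS for constant $k$).** For each of the three objectives (fair $k$-median, fair $k$-means, fair $k$-center) there are a program, a polynomial $p$ and a constant $K$ such that for all $k\ge 1$, $\varepsilon>0$, $n\ge1$, $d$, $\ell$, all $A$ and all $c$, the program on input $(A,c,k,\varepsilon)$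 halts after at most $$K\cdot(d+1)\cdot n^{\,p(k/\min\{\varepsilon,1\})}$$ steps with an output matrix $C$ of the following kind: if a fair $k$-clustering of $(A,c)$ exists, then $C$ is a fair $k$-clustering, and its cost is at most $(1+\varepsilon)$ times the cost of every fair $k$-clustering of $(A,c)$. In particular, for $0<\varepsilon\le 1$ the running time is $O\big(d\cdot n^{\mathrm{poly}(k/\varepsilon)}\big)$ (for $d \ge 1$). -/

import Mathlib

namespace FairClustering

/-! ### Fair clustering in Euclidean space -/

/-- A set `S` of (indices of) points is balanced if all colours occur equally often in it. -/
def Balanced {n ℓ : ℕ} (c : Fin n → Fin ℓ) (S : Finset (Fin n)) : Prop :=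
  ∀ a b : Fin ℓ, (S.filter fun i => c i = a).card = (S.filter fun i => c i = b).card

open Classical in
/-- A fair `k`-clustering, given as an `n × d` matrix `C` whose `i`-th row is the center to which
the `i`-th point is assigned: `C` has at most `k` distinct rows, and for every row the cluster of
all points assigned to it is balanced. -/
def IsFairClustering {n d ℓ : ℕ} (k : ℕ) (c : Fin n → Fin ℓ)
    (C : Fin n → EuclideanSpace ℝ (Fin d)) : Prop :=
  (Finset.univ.image C).card ≤ k ∧
    ∀ j : Fin n, Balanced c (Finset.univ.filter fun i => C i = C j)

/-- The three clustering objectives. -/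
inductive Objective
  | kMedian
  | kMeans
  | kCenter

/-- The cost of assigning the `i`-th point `A i` to the center `C i`, for all `i`: the sum of the
distances, the sum of the squared distances, and the largest distance, respectively. -/
noncomputable def Objective.cost {n d : ℕ} (obj : Objective)
    (A C : Fin n → EuclideanSpace ℝ (Fin d)) : ℝ :=
  match obj with
  | .kMedian => ∑ i, ‖A i - C i‖
  | .kMeans => ∑ i, ‖A i - C i‖ ^ 2
  | .kCenter => ⨆ i, ‖A i - C i‖

/-! ### A real RAM with step count

The memory consists of integer arrays and real arrays, which are numbered and unbounded.  A program
names arrays by fixed numbers and addresses cells by computed integers (indirect addressing).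
Every memory access, constant, arithmetic operation, comparison, Boolean operation and assignment
takes one step.  There are no real constants other than integers, and no rounding operation from
reals to integers. -/

/-- Memory contents: the cell with index `i` of the array with number `a` is `nat a i`
respectively `real a i`. -/
structure Memory where
  nat : ℕ → ℕ → ℕ
  real : ℕ → ℕ → ℝ

/-- Integer expressions. Subtraction is truncated at `0`. -/
inductive NatExpr
  | const (m : ℕ)
  | get (a : ℕ) (i : NatExpr)
  | add (e f : NatExpr)
  | sub (e f : NatExpr)
  | mul (e f : NatExpr)

/-- Real expressions. Division by zero and roots of negative numbers return `0`. -/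
inductive RealExpr
  | cast (e : NatExpr)
  | get (a : ℕ) (i : NatExpr)
  | add (e f : RealExpr)
  | sub (e f : RealExpr)
  | mul (e f : RealExpr)
  | div (e f : RealExpr)
  | sqrt (e : RealExpr)

/-- Boolean expressions. -/
inductive BoolExpr
  | natLT (e f : NatExpr)
  | realLT (e f : RealExpr)
  | not (b : BoolExpr)
  | and (b b' : BoolExpr)

/-- Programs. -/
inductive Program
  | skip
  | setNat (a : ℕ) (i e : NatExpr)
  | setReal (a : ℕ) (i : NatExpr) (e : RealExpr)
  | seq (P Q : Program)
  | ite (b : BoolExpr) (P Q : Program)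
  | while (b : BoolExpr) (P : Program)

def NatExpr.eval (s : Memory) : NatExpr → ℕ
  | .const m => m
  | .get a i => s.nat a (i.eval s)
  | .add e f => e.eval s + f.eval s
  | .sub e f => e.eval s - f.eval s
  | .mul e f => e.eval s * f.eval s

noncomputable def RealExpr.eval (s : Memory) : RealExpr → ℝ
  | .cast e => (e.eval s : ℝ)
  | .get a i => s.real a (i.eval s)
  | .add e f => e.eval s + f.eval s
  | .sub e f => e.eval s - f.eval s
  | .mul e f => e.eval s * f.eval s
  | .div e f => e.eval s / f.eval s
  | .sqrt e => Real.sqrt (e.eval s)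

def BoolExpr.Holds (s : Memory) : BoolExpr → Prop
  | .natLT e f => e.eval s < f.eval s
  | .realLT e f => e.eval s < f.eval s
  | .not b => ¬ b.Holds s
  | .and b b' => b.Holds s ∧ b'.Holds s

/-- Number of steps needed to evaluate an integer expression. -/
def NatExpr.steps : NatExpr → ℕ
  | .const _ => 1
  | .get _ i => i.steps + 1
  | .add e f => e.steps + f.steps + 1
  | .sub e f => e.steps + f.steps + 1
  | .mul e f => e.steps + f.steps + 1

/-- Number of steps needed to evaluate a real expression. -/
def RealExpr.steps : RealExpr → ℕ
  | .cast e => e.steps + 1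
  | .get _ i => i.steps + 1
  | .add e f => e.steps + f.steps + 1
  | .sub e f => e.steps + f.steps + 1
  | .mul e f => e.steps + f.steps + 1
  | .div e f => e.steps + f.steps + 1
  | .sqrt e => e.steps + 1

/-- Number of steps needed to evaluate a Boolean expression. -/
def BoolExpr.steps : BoolExpr → ℕ
  | .natLT e f => e.steps + f.steps + 1
  | .realLT e f => e.steps + f.steps + 1
  | .not b => b.steps + 1
  | .and b b' => b.steps + b'.steps + 1

def Memory.setNat (s : Memory) (a i v : ℕ) : Memory :=
  { s with nat := Function.update s.nat a (Function.update (s.nat a) i v) }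

noncomputable def Memory.setReal (s : Memory) (a i : ℕ) (v : ℝ) : Memory :=
  { s with real := Function.update s.real a (Function.update (s.real a) i v) }

/-- `Exec P s s' t`: started with memory `s`, the program `P` halts after exactly `t` steps with
memory `s'`. -/
inductive Exec : Program → Memory → Memory → ℕ → Prop
  | skip (s : Memory) : Exec .skip s s 1
  | setNat (s : Memory) (a : ℕ) (i e : NatExpr) :
      Exec (.setNat a i e) s (s.setNat a (i.eval s) (e.eval s)) (i.steps + e.steps + 1)
  | setReal (s : Memory) (a : ℕ) (i : NatExpr) (e : RealExpr) :
      Exec (.setReal a i e) s (s.setReal a (i.eval s) (e.eval s)) (i.steps + e.steps + 1)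
  | seq {P Q : Program} {s s' s'' : Memory} {t t' : ℕ} (hP : Exec P s s' t)
      (hQ : Exec Q s' s'' t') : Exec (.seq P Q) s s'' (t + t')
  | iteTrue {b : BoolExpr} {P Q : Program} {s s' : Memory} {t : ℕ} (hb : b.Holds s)
      (hP : Exec P s s' t) : Exec (.ite b P Q) s s' (b.steps + 1 + t)
  | iteFalse {b : BoolExpr} {P Q : Program} {s s' : Memory} {t : ℕ} (hb : ¬ b.Holds s)
      (hQ : Exec Q s s' t) : Exec (.ite b P Q) s s' (b.steps + 1 + t)
  | whileFalse {b : BoolExpr} {P : Program} {s : Memory} (hb : ¬ b.Holds s) :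
      Exec (.while b P) s s (b.steps + 1)
  | whileTrue {b : BoolExpr} {P : Program} {s s' s'' : Memory} {t t' : ℕ} (hb : b.Holds s)
      (hP : Exec P s s' t) (hW : Exec (.while b P) s' s'' t') :
      Exec (.while b P) s s'' (b.steps + 1 + t + t')

/-! ### Input and output -/

/-- The initial memory. Integer array `0` holds `n, d, ℓ, k`, integer array `1` holds the colours of
the points, real array `0` holds `ε`, and real array `1` holds the coordinates of the points, row by
row: coordinate `j` of point `i` has index `i * d + j`. All other cells are `0`. -/
noncomputable def inputMemory {n d ℓ : ℕ} (A : Fin n → EuclideanSpace ℝ (Fin d))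
    (c : Fin n → Fin ℓ) (k : ℕ) (ε : ℝ) : Memory where
  nat
    | 0, 0 => n
    | 0, 1 => d
    | 0, 2 => ℓ
    | 0, 3 => k
    | 1, i => if h : i < n then (c ⟨i, h⟩ : ℕ) else 0
    | _, _ => 0
  real
    | 0, 0 => ε
    | 1, m =>
        if h : m / d < n ∧ m % d < d then A ⟨m / d, h.1⟩ ⟨m % d, h.2⟩ else 0
    | _, _ => 0

/-- The output matrix: coordinate `j` of the center of point `i` is read from the cell with index
`i * d + j` of real array `2`. -/
noncomputable def outputMatrix (n d : ℕ) (s : Memory) : Fin n → EuclideanSpace ℝ (Fin d) :=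
  fun i => WithLp.toLp 2 fun j => s.real 2 (i * d + j)

end FairClustering

namespace FairClustering

/-! ### Memory access -/

/-! Geometry: any center of a cluster can be replaced, at the price of a factor `1 + ε`, by the mean
of `m = ⌈1/ε²⌉` input points, repetitions allowed. This is Maurey's argument: if `p` is a convex
combination of points, some `m` of these points have a mean whose squared distance to `p` is at most
the variance divided by `m` (`exists_norm_sampleMean_sub_sq_le`). For each objective there is a `p`
that is no worse than the given center and has controlled variance: the centroid for k-means, the
combination with weights inversely proportional to the distances (a Weiszfeld step) for k-median,
and the nearest point of the convex hull for k-center. So `n ^ (k * m)` tuples of centers suffice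
(`Objective.exists_cost_sampleMean_le`).

Fairness: a clustering is fair if all colours send the same number of points to each center. Such a
count vector, read in base `n + 1`, is one number below `(n + 1) ^ k`. Once it is guessed, the
colours decouple, and an optimal assignment of one colour class with this code is found by a dynamic
program over pairs (number of points treated, code so far); see `TableCorrect.optimal` and
`Traced.final`. Conversely every assignment with a common code is fair, even if some centers
coincide, because clusters are then unions of fibres with equal counts (`isFairClustering_of_code`).
Trying all guesses of samples and code therefore gives a fair clustering of cost at most `1 + ε`
times that of any other.

Time: for `n ≥ 2`, every loop that does not run over coordinates has at most `Y = n ^ (2 * k + k * m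
+ 1)` rounds. Such loops are nested at most four deep and coordinate loops are never nested, so a
syntactic count (`Program.cost_le`) gives `O((d + 1) * Y ^ 4)` steps. For `n = 1` any power of `n`
is `1`, so the program just copies the point. If there are more colours than points, no fair
clustering exists and the program stops at once. -/

@[simp] theorem Memory.setNat_real (s : Memory) (a i v : ℕ) : (s.setNat a i v).real = s.real := rfl

@[simp] theorem Memory.setReal_nat (s : Memory) (a i : ℕ) (v : ℝ) :
    (s.setReal a i v).nat = s.nat := rfl

@[simp] theorem Memory.setNat_nat (s : Memory) (a i v b j : ℕ) :
    (s.setNat a i v).nat b j = if b = a ∧ j = i then v else s.nat b j := by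
  by_cases hb : b = a
  · subst hb
    by_cases hj : j = i <;> simp [Memory.setNat, hj]
  · simp [Memory.setNat, hb]

@[simp] theorem Memory.setReal_real (s : Memory) (a i b j : ℕ) (v : ℝ) :
    (s.setReal a i v).real b j = if b = a ∧ j = i then v else s.real b j := by
  by_cases hb : b = a
  · subst hb
    by_cases hj : j = i <;> simp [Memory.setReal, hj]
  · simp [Memory.setReal, hb]

theorem Memory.setNat_nat_of_ne (s : Memory) {a b : ℕ} (h : b ≠ a) (i v : ℕ) :
    (s.setNat a i v).nat b = s.nat b := by
  funext j
  simp [h]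

theorem Memory.setReal_real_of_ne (s : Memory) {a b : ℕ} (h : b ≠ a) (i : ℕ) (v : ℝ) :
    (s.setReal a i v).real b = s.real b := by
  funext j
  simp [h]

attribute [simp] NatExpr.eval RealExpr.eval BoolExpr.Holds

/-! ### Static cost of programs -/

/-- The comparisons that bound a loop by the dimension, which is the cell `1` of the integer
array `0`. -/
def BoolExpr.isDimBound : BoolExpr → Bool
  | .natLT _ (.get 0 (.const 1)) => true
  | _ => false

/-- The number of steps of a program in which every execution of a loop bounded by the dimension
takes at most `D` rounds, and every execution of any other loop takes at most `Y` rounds. -/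
def Program.cost (Y D : ℕ) : Program → ℕ
  | .skip => 1
  | .setNat _ i e => i.steps + e.steps + 1
  | .setReal _ i e => i.steps + e.steps + 1
  | .seq P Q => P.cost Y D + Q.cost Y D
  | .ite b P Q => b.steps + 1 + (P.cost Y D + Q.cost Y D)
  | .while b P =>
    (b.steps + 1) + (if b.isDimBound then D else Y) * (b.steps + 1 + P.cost Y D)

/-- Constant factor in the bound `Program.cost_le`. -/
def Program.coeff : Program → ℕ
  | .skip => 1
  | .setNat _ i e => i.steps + e.steps + 1
  | .setReal _ i e => i.steps + e.steps + 1
  | .seq P Q => P.coeff + Q.coeff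
  | .ite b P Q => b.steps + 1 + (P.coeff + Q.coeff)
  | .while b P => (b.steps + 1) + (b.steps + 1 + P.coeff)

/-- Nesting depth of the loops that are not bounded by the dimension. -/
def Program.depth : Program → ℕ
  | .skip => 0
  | .setNat _ _ _ => 0
  | .setReal _ _ _ => 0
  | .seq P Q => max P.depth Q.depth
  | .ite _ P Q => max P.depth Q.depth
  | .while b P => if b.isDimBound then P.depth else P.depth + 1

/-- Nesting depth of the loops that are bounded by the dimension. -/
def Program.dimDepth : Program → ℕ
  | .skip => 0
  | .setNat _ _ _ => 0
  | .setReal _ _ _ => 0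
  | .seq P Q => max P.dimDepth Q.dimDepth
  | .ite _ P Q => max P.dimDepth Q.dimDepth
  | .while b P => if b.isDimBound then P.dimDepth + 1 else P.dimDepth

/-- Each loop level contributes one factor `D + 1` or `Y`. Since both are at least `1`, lower-order
terms are absorbed by raising exponents, and only the coefficients add up. -/
theorem Program.cost_le {Y D : ℕ} (hY : 1 ≤ Y) (P : Program) :
    P.cost Y D ≤ P.coeff * (D + 1) ^ P.dimDepth * Y ^ P.depth := by
  have one_le : ∀ a b : ℕ, 1 ≤ (D + 1) ^ a * Y ^ b := fun a b =>
    Nat.one_le_iff_ne_zero.2 (by positivity)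
  have mono : ∀ c a b a' b' : ℕ, a ≤ a' → b ≤ b' →
      c * (D + 1) ^ a * Y ^ b ≤ c * (D + 1) ^ a' * Y ^ b' := by
    intro c a b a' b' ha hb
    gcongr
    · omega
  have const_le : ∀ c a b : ℕ, c ≤ c * (D + 1) ^ a * Y ^ b := by
    intro c a b
    rw [mul_assoc]
    exact Nat.le_mul_of_pos_right _ (one_le a b)
  induction P with
  | skip => simp [cost, coeff, depth, dimDepth]
  | setNat => simp [cost, coeff, depth, dimDepth]
  | setReal => simp [cost, coeff, depth, dimDepth]
  | seq P Q hP hQ =>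
    simp only [cost, coeff, depth, dimDepth, add_mul]
    exact add_le_add (hP.trans (mono _ _ _ _ _ (le_max_left _ _) (le_max_left _ _)))
      (hQ.trans (mono _ _ _ _ _ (le_max_right _ _) (le_max_right _ _)))
  | ite b P Q hP hQ =>
    simp only [cost, coeff, depth, dimDepth]
    rw [add_mul (b.steps + 1), add_mul _ _ (Y ^ _), add_mul P.coeff,
      add_mul (P.coeff * _)]
    exact add_le_add (const_le _ _ _)
      (add_le_add (hP.trans (mono _ _ _ _ _ (le_max_left _ _) (le_max_left _ _)))
        (hQ.trans (mono _ _ _ _ _ (le_max_right _ _) (le_max_right _ _))))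
  | _ b P hP =>
    simp only [cost, coeff, depth, dimDepth]
    rw [add_mul, add_mul]
    refine add_le_add (const_le _ _ _) ?_
    have h : b.steps + 1 + P.cost Y D ≤
        (b.steps + 1 + P.coeff) * (D + 1) ^ P.dimDepth * Y ^ P.depth := by
      rw [add_mul _ P.coeff, add_mul]
      exact add_le_add (const_le _ _ _) hP
    cases b.isDimBound
    · simp only [Bool.false_eq_true, if_false]
      calc _ ≤ Y * _ := Nat.mul_le_mul_left _ h
        _ = _ := by ring
    · simp only [if_true]
      calc _ ≤ (D + 1) * _ := Nat.mul_le_mul (Nat.le_succ D) h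
        _ = _ := by ring

/-! ### Frames -/

/-- Whether a program assigns to cells of the integer array `a`. -/
def Program.writesNat (a : ℕ) : Program → Bool
  | .skip => false
  | .setNat b _ _ => a == b
  | .setReal _ _ _ => false
  | .seq P Q => P.writesNat a || Q.writesNat a
  | .ite _ P Q => P.writesNat a || Q.writesNat a
  | .while _ P => P.writesNat a

/-- Whether a program assigns to cells of the real array `a`. -/
def Program.writesReal (a : ℕ) : Program → Bool
  | .skip => false
  | .setNat _ _ _ => false
  | .setReal b _ _ => a == b
  | .seq P Q => P.writesReal a || Q.writesReal a
  | .ite _ P Q => P.writesReal a || Q.writesReal a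
  | .while _ P => P.writesReal a

/-- The memories `s` and `s'` agree on all arrays to which the program does not assign. -/
structure Frame (P : Program) (s s' : Memory) : Prop where
  nat : ∀ a, P.writesNat a = false → s'.nat a = s.nat a
  real : ∀ a, P.writesReal a = false → s'.real a = s.real a

theorem Frame.refl (P : Program) (s : Memory) : Frame P s s := ⟨fun _ _ => rfl, fun _ _ => rfl⟩

theorem Frame.trans {P : Program} {s s' s'' : Memory} (h : Frame P s s') (h' : Frame P s' s'') :
    Frame P s s'' :=
  ⟨fun a ha => (h'.nat a ha).trans (h.nat a ha), fun a ha => (h'.real a ha).trans (h.real a ha)⟩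

theorem Frame.setNat {P : Program} {s s' : Memory} {a : ℕ} (h : Frame P s s')
    (ha : P.writesNat a = true) (i v : ℕ) : Frame P s (s'.setNat a i v) := by
  refine ⟨fun c hc => ?_, h.real⟩
  have hca : c ≠ a := by rintro rfl; simp [ha] at hc
  rw [← h.nat c hc]
  funext j
  simp [hca]

/-- Array numbers are literals in the program text, so which arrays stay unchanged is decidable from
the syntax. Later proofs obtain all such facts by `rfl` and keep loop invariants short. -/
theorem Exec.frame {P : Program} {s s' : Memory} {t : ℕ} (h : Exec P s s' t) : Frame P s s' := by
  induction h with
  | skip => exact .refl _ _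
  | setNat s a i e =>
    refine ⟨fun b hb => ?_, fun b _ => rfl⟩
    have hb : b ≠ a := by simpa [Program.writesNat] using hb
    funext j
    simp [hb]
  | setReal s a i e =>
    refine ⟨fun b _ => rfl, fun b hb => ?_⟩
    have hb : b ≠ a := by simpa [Program.writesReal] using hb
    funext j
    simp [hb]
  | seq _ _ h h' =>
    refine ⟨fun b hb => ?_, fun b hb => ?_⟩
    · simp only [Program.writesNat, Bool.or_eq_false_iff] at hb
      exact (h'.nat b hb.2).trans (h.nat b hb.1)
    · simp only [Program.writesReal, Bool.or_eq_false_iff] at hb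
      exact (h'.real b hb.2).trans (h.real b hb.1)
  | iteTrue _ _ h =>
    refine ⟨fun b hb => ?_, fun b hb => ?_⟩
    · simp only [Program.writesNat, Bool.or_eq_false_iff] at hb
      exact h.nat b hb.1
    · simp only [Program.writesReal, Bool.or_eq_false_iff] at hb
      exact h.real b hb.1
  | iteFalse _ _ h =>
    refine ⟨fun b hb => ?_, fun b hb => ?_⟩
    · simp only [Program.writesNat, Bool.or_eq_false_iff] at hb
      exact h.nat b hb.2
    · simp only [Program.writesReal, Bool.or_eq_false_iff] at hb
      exact h.real b hb.2
  | whileFalse => exact .refl _ _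
  | whileTrue _ _ _ h h' => exact Frame.trans ⟨fun b hb => h.nat b hb, fun b hb => h.real b hb⟩ h'

/-! ### Total correctness within the static cost -/

/-- Started with memory `s`, the program `P` halts within `P.cost Y D` steps, and then `Q` holds. -/
def Runs (Y D : ℕ) (P : Program) (s : Memory) (Q : Memory → Prop) : Prop :=
  ∃ s' t, Exec P s s' t ∧ t ≤ P.cost Y D ∧ Q s'

section

variable {Y D : ℕ} {P P' : Program} {s : Memory} {Q Q' : Memory → Prop}

theorem Runs.mono (h : Runs Y D P s Q) (hQ : ∀ s', Frame P s s' → Q s' → Q' s') :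
    Runs Y D P s Q' := by
  obtain ⟨s', t, he, ht, hs⟩ := h
  exact ⟨s', t, he, ht, hQ s' he.frame hs⟩

theorem Runs.skip (h : Q s) : Runs Y D .skip s Q := ⟨s, 1, .skip s, le_rfl, h⟩

theorem Runs.setNat {a : ℕ} {i e : NatExpr} (h : Q (s.setNat a (i.eval s) (e.eval s))) :
    Runs Y D (.setNat a i e) s Q := ⟨_, _, .setNat s a i e, le_rfl, h⟩

theorem Runs.setReal {a : ℕ} {i : NatExpr} {e : RealExpr}
    (h : Q (s.setReal a (i.eval s) (e.eval s))) :
    Runs Y D (.setReal a i e) s Q := ⟨_, _, .setReal s a i e, le_rfl, h⟩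

theorem Runs.seq (h : Runs Y D P s fun s' => Runs Y D P' s' Q) : Runs Y D (.seq P P') s Q := by
  obtain ⟨s', t, he, ht, s'', t', he', ht', hs⟩ := h
  exact ⟨s'', t + t', he.seq he', add_le_add ht ht', hs⟩

/-- Sequential composition, with a postcondition of the first program and its frame. -/
theorem Runs.comp {R : Memory → Prop} (h : Runs Y D P s R)
    (h' : ∀ s', Frame P s s' → R s' → Runs Y D P' s' Q) : Runs Y D (.seq P P') s Q :=
  .seq (h.mono h')

theorem Runs.ite {b : BoolExpr} (h : b.Holds s → Runs Y D P s Q)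
    (h' : ¬ b.Holds s → Runs Y D P' s Q) : Runs Y D (.ite b P P') s Q := by
  by_cases hb : b.Holds s
  · obtain ⟨s', t, he, ht, hs⟩ := h hb
    exact ⟨s', _, .iteTrue hb he, by simp only [Program.cost]; omega, hs⟩
  · obtain ⟨s', t, he, ht, hs⟩ := h' hb
    exact ⟨s', _, .iteFalse hb he, by simp only [Program.cost]; omega, hs⟩

/-- The number `N` of rounds is fixed in advance and the invariant is indexed by the round, so
correctness, termination and the step bound come from one induction on the remaining rounds. -/
theorem Runs.whileLoop {b : BoolExpr} (N : ℕ) (Inv : ℕ → Memory → Prop)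
    (hN : N ≤ if b.isDimBound then D else Y) (h0 : Inv 0 s)
    (hstep : ∀ i < N, ∀ s, Inv i s → b.Holds s ∧ Runs Y D P s (Inv (i + 1)))
    (hend : ∀ s, Inv N s → ¬ b.Holds s) : Runs Y D (.while b P) s (Inv N) := by
  have key : ∀ j i s, i + j = N → Inv i s → ∃ s' t, Exec (.while b P) s s' t ∧
      t ≤ (b.steps + 1) + j * (b.steps + 1 + P.cost Y D) ∧ Inv N s' := by
    intro j
    induction j with
    | zero =>
      intro i s hi hs
      obtain rfl : i = N := hi
      exact ⟨s, _, .whileFalse (hend s hs), by omega, hs⟩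
    | succ j ih =>
      intro i s hi hs
      obtain ⟨hb, s', t, he, ht, hs'⟩ := hstep i (by omega) s hs
      obtain ⟨s'', t', he', ht', hs''⟩ := ih (i + 1) s' (by omega) hs'
      refine ⟨s'', _, .whileTrue hb he he', ?_, hs''⟩
      rw [add_mul]
      omega
  obtain ⟨s', t, he, ht, hs⟩ := key N 0 s (zero_add N) h0
  exact ⟨s', t, he, ht.trans (Nat.add_le_add_left (Nat.mul_le_mul_right _ hN) _), hs⟩

/-- The scalar integer variable stored in the cell `0` of the array `a`. -/
abbrev NatExpr.var (a : ℕ) : NatExpr := .get a (.const 0)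

/-- The scalar real variable stored in the cell `0` of the array `a`. -/
abbrev RealExpr.var (a : ℕ) : RealExpr := .get a (.const 0)

/-- Assignment to a scalar integer variable. -/
abbrev Program.letNat (a : ℕ) (e : NatExpr) : Program := .setNat a (.const 0) e

/-- Assignment to a scalar real variable. -/
abbrev Program.letReal (a : ℕ) (e : RealExpr) : Program := .setReal a (.const 0) e

/-- `for v = 0, …, b - 1 do P`. -/
def Program.forLoop (v : ℕ) (b : NatExpr) (P : Program) : Program :=
  .seq (.letNat v (.const 0))
    (.while (.natLT (.var v) b) (.seq P (.letNat v (.add (.var v) (.const 1)))))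

/-- The bound `b` is evaluated anew in every round; `hb` says that nothing the loop writes can
change its value. The frame relative to the start is carried along as part of the invariant. -/
theorem Runs.forLoop {v : ℕ} {b : NatExpr} (N : ℕ) (Inv : ℕ → Memory → Prop)
    (hN : N ≤ if (BoolExpr.natLT (.var v) b).isDimBound then D else Y)
    (hv : P.writesNat v = false)
    (hb : ∀ s', Frame (.forLoop v b P) s s' → b.eval s' = N)
    (h0 : Inv 0 (s.setNat v 0 0))
    (hstep : ∀ i < N, ∀ s', Frame (.forLoop v b P) s s' → s'.nat v 0 = i → Inv i s' →
      Runs Y D P s' fun s'' => Inv (i + 1) (s''.setNat v 0 (i + 1)))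
    (hend : ∀ s', Frame (.forLoop v b P) s s' → Inv N s' → Q s') :
    Runs Y D (.forLoop v b P) s Q := by
  have setv : ∀ (s' : Memory) (x : ℕ), Frame (.forLoop v b P) s' (s'.setNat v 0 x) := by
    intro s' x
    refine ⟨fun a ha => ?_, fun a _ => rfl⟩
    have ha : ¬ a = v := by
      simp only [Program.forLoop, Program.writesNat, Bool.or_eq_false_iff, beq_eq_false_iff_ne,
        ne_eq] at ha
      exact ha.1
    funext j
    simp [ha]
  have body : ∀ s' s'', Frame P s' s'' → Frame (.forLoop v b P) s' s'' := by
    intro s' s'' h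
    refine ⟨fun a ha => h.nat a ?_, fun a ha => h.real a ?_⟩
    · simp only [Program.forLoop, Program.writesNat, Bool.or_eq_false_iff] at ha
      exact ha.2.1
    · simp only [Program.forLoop, Program.writesReal, Bool.or_eq_false_iff] at ha
      exact ha.2.1
  refine .seq (.setNat ?_)
  refine (Runs.whileLoop N (fun i s' => Frame (.forLoop v b P) s s' ∧ s'.nat v 0 = i ∧ Inv i s')
    hN ⟨setv s 0, by simp, h0⟩ ?_ ?_).mono (fun s' _ h => hend s' h.1 h.2.2)
  · rintro i hi s' ⟨hF, hvi, hI⟩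
    refine ⟨by simp [hvi, hb s' hF, hi], .seq ?_⟩
    refine (hstep i hi s' hF hvi hI).mono fun s'' hF' hI' => .setNat ?_
    have : s''.nat v 0 = i := by rw [hF'.nat v hv, hvi]
    refine ⟨(hF.trans (body _ _ hF')).trans (setv _ _), by simp [this], ?_⟩
    simpa [this] using hI'
  · rintro s' ⟨hF, hvi, -⟩
    simp [hvi, hb s' hF]

end

/-! ### Accumulated costs -/

/-- The operation that combines the costs of single points: the maximum for `k`-center, and
addition otherwise. -/
noncomputable def Objective.op (obj : Objective) (x y : ℝ) : ℝ :=
  match obj with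
  | .kCenter => max x y
  | _ => x + y

/-- The combined cost of the points `0, …, n - 1` with costs `f 0, …, f (n - 1)`. -/
noncomputable def Objective.total (obj : Objective) (f : ℕ → ℝ) : ℕ → ℝ
  | 0 => 0
  | n + 1 => obj.op (obj.total f n) (f n)

theorem Objective.op_mono (obj : Objective) {x x' : ℝ} (h : x ≤ x') (y : ℝ) :
    obj.op x y ≤ obj.op x' y := by
  cases obj
  · exact add_le_add_left h y
  · exact add_le_add_left h y
  · exact max_le_max h le_rfl

theorem Objective.op_nonneg (obj : Objective) {x y : ℝ} (hx : 0 ≤ x) (hy : 0 ≤ y) :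
    0 ≤ obj.op x y := by
  cases obj
  · exact add_nonneg hx hy
  · exact add_nonneg hx hy
  · exact le_max_of_le_left hx

/-- Lets points of other colours count as cost `0` for all three objectives; for the maximum this
needs nonnegativity. -/
theorem Objective.op_zero (obj : Objective) {x : ℝ} (hx : 0 ≤ x) : obj.op x 0 = x := by
  cases obj <;> simp [Objective.op, hx]

theorem Objective.total_nonneg (obj : Objective) {f : ℕ → ℝ} {n : ℕ}
    (hf : ∀ i < n, 0 ≤ f i) : 0 ≤ obj.total f n := by
  induction n with
  | zero => exact le_rfl
  | succ n ih => exact obj.op_nonneg (ih fun i hi => hf i (by omega)) (hf n (by omega))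

theorem Objective.total_congr (obj : Objective) {f g : ℕ → ℝ} {n : ℕ}
    (h : ∀ i < n, f i = g i) : obj.total f n = obj.total g n := by
  induction n with
  | zero => rfl
  | succ n ih => simp only [total]; rw [ih fun i hi => h i (by omega), h n (by omega)]

theorem Objective.total_eq_sum (obj : Objective) (h : obj ≠ .kCenter) (f : ℕ → ℝ) (n : ℕ) :
    obj.total f n = ∑ i ∈ Finset.range n, f i := by
  induction n with
  | zero => simp [total]
  | succ n ih =>
    rw [Finset.sum_range_succ, ← ih, total]
    cases obj <;> simp_all [op]

theorem Objective.total_kCenter_le_iff {f : ℕ → ℝ} {n : ℕ} {x : ℝ} (hx : 0 ≤ x) :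
    Objective.kCenter.total f n ≤ x ↔ ∀ i < n, f i ≤ x := by
  induction n with
  | zero => simp [total, hx]
  | succ n ih =>
    rw [total, op, max_le_iff, ih]
    exact ⟨fun h i hi => (Nat.lt_succ_iff_lt_or_eq.1 hi).elim (h.1 i) fun hi => hi ▸ h.2,
      fun h => ⟨fun i hi => h i (by omega), h n (by omega)⟩⟩

/-- If on every colour class the combined cost `f` is at most that of `g`, then this holds for the
set of all points. -/
theorem Objective.total_le_of_classes (obj : Objective) {f g : ℕ → ℝ} {n ℓ : ℕ} {col : ℕ → ℕ}
    (hcol : ∀ i < n, col i < ℓ) (hg : ∀ i < n, 0 ≤ g i)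
    (h : ∀ a < ℓ, obj.total (fun i => if col i = a then f i else 0) n ≤
      obj.total (fun i => if col i = a then g i else 0) n) :
    obj.total f n ≤ obj.total g n := by
  by_cases hobj : obj = .kCenter
  · subst hobj
    have hg0 := kCenter.total_nonneg hg
    rw [total_kCenter_le_iff hg0]
    intro i hi
    -- Dropping the other colours can only lower the maximum, since `g` is nonnegative.
    have h1 : Objective.kCenter.total (fun i' => if col i' = col i then g i' else 0) n ≤
        Objective.kCenter.total g n := by
      rw [total_kCenter_le_iff hg0]
      intro i' hi'
      split_ifs
      · exact (total_kCenter_le_iff hg0).1 le_rfl i' hi'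
      · exact hg0
    have := (total_kCenter_le_iff hg0).1 ((h _ (hcol i hi)).trans h1) i hi
    simpa using this
  · have fib : ∀ u : ℕ → ℝ, ∑ i ∈ Finset.range n, u i =
        ∑ a ∈ Finset.range ℓ, ∑ i ∈ Finset.range n, if col i = a then u i else 0 := by
      intro u
      rw [Finset.sum_comm]
      refine Finset.sum_congr rfl fun i hi => ?_
      rw [Finset.sum_ite_eq, if_pos]
      exact Finset.mem_range.2 (hcol i (Finset.mem_range.1 hi))
    simp only [total_eq_sum _ hobj] at h ⊢
    rw [fib f, fib g]
    exact Finset.sum_le_sum fun a ha => h a (Finset.mem_range.1 ha)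

/-! ### The dynamic program for one colour class

The points `0, …, n - 1` of colour `a` are assigned to centers `0, …, k - 1`; assigning the point `i`
to the center `j` costs `w i j`. The code of an assignment is the sum of the numbers `b j` over all
assigned points, where `j` is the center of the point. -/

section

/-- The code of the assignment `τ` restricted to the points below `n` of colour `a`. -/
def classCode (col : ℕ → ℕ) (b : ℕ → ℕ) (a : ℕ) (τ : ℕ → ℕ) : ℕ → ℕ
  | 0 => 0
  | n + 1 => classCode col b a τ n + if col n = a then b (τ n) else 0

/-- The combined cost of the assignment `τ` on the points below `n` of colour `a`. -/
noncomputable def classCost (obj : Objective) (col : ℕ → ℕ) (w : ℕ → ℕ → ℝ) (a : ℕ) (τ : ℕ → ℕ)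
    (n : ℕ) : ℝ :=
  obj.total (fun i => if col i = a then w i (τ i) else 0) n

/-- The center `j` can be used for the point that belongs to the table cell `x`. -/
def Usable (R : ℕ) (b : ℕ → ℕ) (T : ℕ → ℝ) (x j : ℕ) : Prop :=
  b j ≤ x % R ∧ 0 ≤ T (x - b j)

/-- The table entry `T (x + R)` is obtained by the recursion of the dynamic program for the point
`x / R`, and `back x` is a minimizer, among the centers below `k`; negative entries are infeasible. -/
def CellCorrect (obj : Objective) (w : ℕ → ℕ → ℝ) (R : ℕ) (b : ℕ → ℕ)
    (T : ℕ → ℝ) (back : ℕ → ℕ) (k x : ℕ) : Prop :=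
  (T (x + R) < 0 ∧ ∀ j < k, ¬ Usable R b T x j) ∨
  (0 ≤ T (x + R) ∧ back x < k ∧ Usable R b T x (back x) ∧
    T (x + R) = obj.op (T (x - b (back x))) (w (x / R) (back x)) ∧
    ∀ j < k, Usable R b T x j → T (x + R) ≤ obj.op (T (x - b j)) (w (x / R) j))

/-- The entries `T y` with `y < N + R` of the table of the dynamic program are correct. -/
structure TableCorrect (obj : Objective) (col : ℕ → ℕ) (w : ℕ → ℕ → ℝ) (a R : ℕ) (b : ℕ → ℕ)
    (k N : ℕ) (T : ℕ → ℝ) (back : ℕ → ℕ) : Prop where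
  zero : T 0 = 0
  neg : ∀ r, 0 < r → r < R → T r < 0
  skip : ∀ x < N, col (x / R) ≠ a → T (x + R) = T x
  step : ∀ x < N, col (x / R) = a → CellCorrect obj w R b T back k x

variable {obj : Objective} {col : ℕ → ℕ} {w : ℕ → ℕ → ℝ} {a R : ℕ} {b : ℕ → ℕ} {k n : ℕ}
  {T : ℕ → ℝ} {back : ℕ → ℕ}

/-- The scan of the centers for one cell: center `j` is unusable or brings no improvement, so entry
and minimizer stay. -/
theorem CellCorrect.keep {j x : ℕ} (h : CellCorrect obj w R b T back j x)
    (hj : ¬ (Usable R b T x j ∧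
      (T (x + R) < 0 ∨ obj.op (T (x - b j)) (w (x / R) j) < T (x + R)))) :
    CellCorrect obj w R b T back (j + 1) x := by
  rcases h with ⟨h1, h2⟩ | ⟨h1, h2, h3, h4, h5⟩
  · refine .inl ⟨h1, fun j' hj' hu => ?_⟩
    rcases Nat.lt_succ_iff_lt_or_eq.1 hj' with hlt | rfl
    · exact h2 j' hlt hu
    · exact hj ⟨hu, .inl h1⟩
  · refine .inr ⟨h1, by omega, h3, h4, fun j' hj' hu => ?_⟩
    rcases Nat.lt_succ_iff_lt_or_eq.1 hj' with hlt | rfl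
    · exact h5 j' hlt hu
    · exact not_lt.1 fun h => hj ⟨hu, .inr h⟩

/-- Center `j` improves the entry. Only the cell `x + R` is overwritten, while the recursion reads
cells `x - b j'`, which differ from it because `R > 0`. -/
theorem CellCorrect.update {j x : ℕ} {T' : ℕ → ℝ} {back' : ℕ → ℕ} (hR : 0 < R)
    (hw : 0 ≤ w (x / R) j) (h : CellCorrect obj w R b T back j x) (hu : Usable R b T x j)
    (hlt : T (x + R) < 0 ∨ obj.op (T (x - b j)) (w (x / R) j) < T (x + R))
    (hT : ∀ y, y ≠ x + R → T' y = T y)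
    (hT' : T' (x + R) = obj.op (T (x - b j)) (w (x / R) j)) (hback : back' x = j) :
    CellCorrect obj w R b T' back' (j + 1) x := by
  have hs : ∀ j', T' (x - b j') = T (x - b j') := fun j' => hT _ (by omega)
  have hus : ∀ j', Usable R b T' x j' ↔ Usable R b T x j' := fun j' => by simp [Usable, hs]
  refine .inr ⟨hT' ▸ obj.op_nonneg hu.2 hw, by omega, ?_, ?_, ?_⟩
  · rw [hback, hus]; exact hu
  · rw [hT', hback, hs]
  · intro j' hj' hu'
    rw [hus] at hu'
    rw [hT', hs]
    rcases Nat.lt_succ_iff_lt_or_eq.1 hj' with hj' | rfl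
    · rcases h with ⟨h1, h2⟩ | ⟨h1, h2, h3, h4, h5⟩
      · exact absurd hu' (h2 j' hj')
      · rcases hlt with hlt | hlt
        · linarith
        · exact hlt.le.trans (h5 j' hj' hu')
    · exact le_rfl

/-- The state "`i` points treated, code `r`" has index `i * R + r`, so the new entry `N + R` depends
on entries up to `N` only and leaves the earlier ones valid. -/
theorem TableCorrect.succ {N : ℕ} {T' : ℕ → ℝ} {back' : ℕ → ℕ} (hR : 0 < R)
    (h : TableCorrect obj col w a R b k N T back) (hT : ∀ y < N + R, T' y = T y)
    (hback : ∀ y < N, back' y = back y) (hskip : col (N / R) ≠ a → T' (N + R) = T' N)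
    (hstep : col (N / R) = a → CellCorrect obj w R b T' back' k N) :
    TableCorrect obj col w a R b k (N + 1) T' back' := by
  refine ⟨by rw [hT 0 (by omega), h.zero], fun r h0 hr => ?_, fun x hx hc => ?_,
    fun x hx hc => ?_⟩
  · rw [hT r (by omega)]; exact h.neg r h0 hr
  · rcases Nat.lt_succ_iff_lt_or_eq.1 hx with hlt | rfl
    · rw [hT _ (by omega), hT _ (by omega)]; exact h.skip x hlt hc
    · exact hskip hc
  · rcases Nat.lt_succ_iff_lt_or_eq.1 hx with hlt | rfl
    · have := h.step x hlt hc
      have hs : ∀ j', T' (x - b j') = T (x - b j') := fun j' => hT _ (by omega)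
      simpa only [CellCorrect, Usable, hs, hT (x + R) (by omega), hback x hlt] using this
    · exact hstep hc

theorem classCode_congr {τ τ' : ℕ → ℕ} (h : ∀ i < n, col i = a → τ i = τ' i) :
    classCode col b a τ n = classCode col b a τ' n := by
  induction n with
  | zero => rfl
  | succ n ih =>
    simp only [classCode]
    rw [ih fun i hi => h i (by omega)]
    split_ifs with hc
    · rw [h n (by omega) hc]
    · rfl

theorem classCost_congr {τ τ' : ℕ → ℕ} (h : ∀ i < n, col i = a → τ i = τ' i) :
    classCost obj col w a τ n = classCost obj col w a τ' n := by
  refine obj.total_congr fun i hi => ?_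
  split_ifs with hc
  · rw [h i hi hc]
  · rfl

/-- The lower-bound half of the dynamic program, by induction along the prefixes of `τ`. Prefix
codes increase with `i`, so if the code of a prefix is below `R`, all shorter ones stay inside the
table too. A usable predecessor keeps the entry feasible. -/
theorem TableCorrect.optimal (h : TableCorrect obj col w a R b k (n * R) T back)
    {τ : ℕ → ℕ} (hτ : ∀ i < n, τ i < k) :
    ∀ i ≤ n, classCode col b a τ i < R →
      0 ≤ T (i * R + classCode col b a τ i) ∧
        T (i * R + classCode col b a τ i) ≤ classCost obj col w a τ i := by
  intro i
  induction i with
  | zero => intro _ _; simp [classCode, classCost, Objective.total, h.zero]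
  | succ i ih =>
    intro hi hR
    have hRpos : 0 < R := by omega
    have hle : classCode col b a τ i ≤ classCode col b a τ (i + 1) := Nat.le_add_right _ _
    obtain ⟨ih0, ih1⟩ := ih (by omega) (by omega)
    set c := classCode col b a τ i with hc
    set c' := classCode col b a τ (i + 1) with hc'
    have hx : i * R + c' < n * R := by nlinarith
    have hdiv : (i * R + c') / R = i := by
      rw [mul_comm, Nat.mul_add_div hRpos, Nat.div_eq_of_lt hR, add_zero]
    have hmod : (i * R + c') % R = c' := by
      rw [mul_comm, Nat.mul_add_mod, Nat.mod_eq_of_lt hR]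
    have hidx : (i + 1) * R + c' = i * R + c' + R := by ring
    have hcost : classCost obj col w a τ (i + 1) = obj.op (classCost obj col w a τ i)
      (if col i = a then w i (τ i) else 0) := rfl
    rw [hidx, hcost]
    by_cases hcol : col i = a
    · have hcc : c' = c + b (τ i) := by simp [hc', classCode, hcol, hc]
      have hsub : i * R + c' - b (τ i) = i * R + c := by omega
      have hus : Usable R b T (i * R + c') (τ i) := ⟨by omega, by rw [hsub]; exact ih0⟩
      rcases h.step _ hx (by rw [hdiv, hcol]) with h1 | h1
      · exact absurd hus (h1.2 _ (hτ i (by omega)))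
      · refine ⟨h1.1, (h1.2.2.2.2 _ (hτ i (by omega)) hus).trans ?_⟩
        rw [hsub, hdiv, if_pos hcol]
        exact obj.op_mono ih1 _
    · have hcc : c' = c := by simp [hc', classCode, hcol, hc]
      rw [h.skip _ hx (by rw [hdiv]; exact hcol), if_neg hcol, hcc]
      exact ⟨ih0, ih1.trans (obj.op_zero (ih0.trans ih1)).ge⟩

/-- Invariant of the reconstruction of an optimal assignment `σ` of the points of colour `a`: it
remains to assign the points below `i` with code `rc`. -/
structure Traced (obj : Objective) (col : ℕ → ℕ) (w : ℕ → ℕ → ℝ) (a R : ℕ) (b : ℕ → ℕ)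
    (k n : ℕ) (T : ℕ → ℝ) (r : ℕ) (i rc : ℕ) (σ : ℕ → ℕ) : Prop where
  lt : rc < R
  nonneg : 0 ≤ T (i * R + rc)
  center_lt : ∀ i' < n, i ≤ i' → col i' = a → σ i' < k
  extend : ∀ τ : ℕ → ℕ, (∀ i' < n, i ≤ i' → col i' = a → τ i' = σ i') →
    classCode col b a τ i = rc → classCost obj col w a τ i = T (i * R + rc) →
    classCode col b a τ n = r ∧ classCost obj col w a τ n = T (n * R + r)

theorem Traced.init {r : ℕ} (hr : r < R) (h : 0 ≤ T (n * R + r)) (σ : ℕ → ℕ) :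
    Traced obj col w a R b k n T r n r σ :=
  ⟨hr, h, fun i' h1 h2 => by omega, fun τ _ h1 h2 => ⟨h1, h2⟩⟩

theorem Traced.skip (h : TableCorrect obj col w a R b k (n * R) T back) {r i rc : ℕ} {σ : ℕ → ℕ}
    (hi : i < n) (hcol : col i ≠ a) (ht : Traced obj col w a R b k n T r (i + 1) rc σ) :
    Traced obj col w a R b k n T r i rc σ := by
  have hrc := ht.lt
  have hRpos : 0 < R := by omega
  have hx : i * R + rc < n * R := by nlinarith
  have hdiv : (i * R + rc) / R = i := by
    rw [mul_comm, Nat.mul_add_div hRpos, Nat.div_eq_of_lt hrc, add_zero]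
  have hT : T ((i + 1) * R + rc) = T (i * R + rc) := by
    rw [← h.skip _ hx (by rw [hdiv]; exact hcol)]
    congr 1
    ring
  refine ⟨hrc, hT ▸ ht.nonneg, fun i' h1 h2 h3 => ht.center_lt i' h1 ?_ h3, ?_⟩
  · rcases h2.eq_or_lt with rfl | h2
    · exact absurd h3 hcol
    · exact h2
  · intro τ h1 h2 h3
    refine ht.extend τ (fun i' h4 h5 => h1 i' h4 (by omega)) ?_ ?_
    · simp [classCode, hcol, h2]
    · have : classCost obj col w a τ (i + 1) = obj.op (classCost obj col w a τ i)
        (if col i = a then w i (τ i) else 0) := rfl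
      rw [this, if_neg hcol, h3, hT, obj.op_zero (hT ▸ ht.nonneg)]

/-- Following `back` extends the reconstructed suffix by one point. Since `extend` speaks of every
completion `τ` of that suffix, code and cost of an assignment never have to be split into a prefix
and a suffix part. -/
theorem Traced.step (h : TableCorrect obj col w a R b k (n * R) T back) {r i rc : ℕ} {σ σ' : ℕ → ℕ}
    (hi : i < n) (hcol : col i = a) (ht : Traced obj col w a R b k n T r (i + 1) rc σ)
    (hσ : σ' i = back (i * R + rc)) (hσ' : ∀ i', i' ≠ i → σ' i' = σ i') :
    Traced obj col w a R b k n T r i (rc - b (back (i * R + rc))) σ' := by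
  have hrc := ht.lt
  have hRpos : 0 < R := by omega
  have hx : i * R + rc < n * R := by nlinarith
  have hdiv : (i * R + rc) / R = i := by
    rw [mul_comm, Nat.mul_add_div hRpos, Nat.div_eq_of_lt hrc, add_zero]
  have hmod : (i * R + rc) % R = rc := by
    rw [mul_comm, Nat.mul_add_mod, Nat.mod_eq_of_lt hrc]
  have hidx : (i + 1) * R + rc = i * R + rc + R := by ring
  have hnn := ht.nonneg
  rw [hidx] at hnn
  rcases h.step _ hx (by rw [hdiv, hcol]) with h1 | h1
  · exact absurd hnn (not_le.2 h1.1)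
  obtain ⟨-, hk, hus, heq, -⟩ := h1
  set j := back (i * R + rc)
  have hbj : b j ≤ rc := hmod ▸ hus.1
  have hsub : i * R + rc - b j = i * R + (rc - b j) := by omega
  rw [hsub, hdiv] at heq
  refine ⟨by omega, by rw [← hsub]; exact hus.2, fun i' h1 h2 h3 => ?_, ?_⟩
  · by_cases hii : i' = i
    · rw [hii, hσ]; exact hk
    · rw [hσ' i' hii]; exact ht.center_lt i' h1 (by omega) h3
  · intro τ h1 h2 h3
    have hτ : τ i = j := by rw [h1 i hi le_rfl hcol, hσ]
    refine ht.extend τ (fun i' h4 h5 h6 => ?_) ?_ ?_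
    · rw [h1 i' h4 (by omega) h6, hσ' i' (by omega)]
    · simp only [classCode, hcol, if_true, h2, hτ]
      omega
    · have : classCost obj col w a τ (i + 1) = obj.op (classCost obj col w a τ i)
        (if col i = a then w i (τ i) else 0) := rfl
      rw [this, if_pos hcol, h3, hτ, hidx, heq]

/-- In row `0` the only feasible entry is the one with code `0`, so the whole code has been used up
and the empty prefix completes the suffix. -/
theorem Traced.final (h : TableCorrect obj col w a R b k (n * R) T back) {r rc : ℕ} {σ : ℕ → ℕ}
    (ht : Traced obj col w a R b k n T r 0 rc σ) :
    classCode col b a σ n = r ∧ classCost obj col w a σ n = T (n * R + r) := by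
  have hrc : rc = 0 := by
    by_contra h0
    have := ht.nonneg
    rw [zero_mul, zero_add] at this
    exact absurd this (not_le.2 (h.neg rc (by omega) ht.lt))
  subst hrc
  refine ht.extend σ (fun _ _ _ _ => rfl) rfl ?_
  simp [classCost, Objective.total, h.zero]

end

/-! ### The program

Use of the integer arrays, besides the input:
`2`: sample size `m`; `3`: powers of `n + 1`; `4`: number `R` of codes; `5`: number of guesses;
`6`: `k * m`; `7`: `n * k`; `8`: `n * R`; `9`: the guess; `10`, `11`: quotient and remainder;
`12`: the code that every colour class has to have; `13`, `14`: for the conversion of the guess;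
`15`: the sampled points; `16`: a center; `17`: a coordinate; `18`: position in a sample;
`19`: position in the array of weights or the table; `20`: a center; `21`: a colour;
`22`: minimizers of the dynamic program; `23`: remaining code; `24`: the assignment;
`25`: whether the guess is feasible; `26`, `27`, `28`, `30`: points; `29`: whether a solution
has been found.

Use of the real arrays: `2`: output; `3`: a coordinate of a center; `4`: weights; `5`: a distance;
`6`: table of the dynamic program; `7`: cost of the current solution; `8`: least cost so far. -/

/-- The number of points. -/
abbrev nE : NatExpr := .get 0 (.const 0)

/-- The dimension. -/
abbrev dE : NatExpr := .get 0 (.const 1)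

/-- The number of colours. -/
abbrev lE : NatExpr := .get 0 (.const 2)

/-- The number of centers. -/
abbrev kE : NatExpr := .get 0 (.const 3)

/-- The memory holds the input and the auxiliary numbers that are computed once; all of them are
at most `Y`, as far as they bound loops. -/
structure Ready (Y n d ℓ k m : ℕ) (X : ℕ → ℝ) (col : ℕ → ℕ) (s : Memory) : Prop where
  n_eq : s.nat 0 0 = n
  d_eq : s.nat 0 1 = d
  l_eq : s.nat 0 2 = ℓ
  k_eq : s.nat 0 3 = k
  col_eq : s.nat 1 = col
  point_eq : s.real 1 = X
  m_eq : s.nat 2 0 = m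
  pow_eq : ∀ j < k, s.nat 3 j = (n + 1) ^ j
  R_eq : s.nat 4 0 = (n + 1) ^ k
  guess_eq : s.nat 5 0 = (n + 1) ^ k * n ^ (k * m)
  km_eq : s.nat 6 0 = k * m
  nk_eq : s.nat 7 0 = n * k
  nR_eq : s.nat 8 0 = n * (n + 1) ^ k
  one_le_n : 1 ≤ n
  one_le_k : 1 ≤ k
  l_le : ℓ ≤ n
  n_le : n ≤ Y
  k_le : k ≤ Y
  m_le : m ≤ Y
  R_le : (n + 1) ^ k ≤ Y
  guess_le : (n + 1) ^ k * n ^ (k * m) ≤ Y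
  km_le : k * m ≤ Y
  nk_le : n * k ≤ Y
  nR_le : n * (n + 1) ^ k ≤ Y

/-! ### Preserved input data, decoding of a guess, and the costs of single assignments -/

section

variable {Y n d ℓ k m : ℕ} {X : ℕ → ℝ} {col : ℕ → ℕ} {s s' : Memory} {P : Program}
  {obj : Objective}

theorem Ready.frame (h : Ready Y n d ℓ k m X col s) (hF : Frame P s s')
    (hnat : ∀ a ≤ 8, P.writesNat a = false) (hreal : P.writesReal 1 = false) :
    Ready Y n d ℓ k m X col s' := by
  have e0 := hF.nat 0 (hnat 0 (by norm_num))
  have e1 := hF.nat 1 (hnat 1 (by norm_num))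
  have e2 := hF.nat 2 (hnat 2 (by norm_num))
  have e3 := hF.nat 3 (hnat 3 (by norm_num))
  have e4 := hF.nat 4 (hnat 4 (by norm_num))
  have e5 := hF.nat 5 (hnat 5 (by norm_num))
  have e6 := hF.nat 6 (hnat 6 (by norm_num))
  have e7 := hF.nat 7 (hnat 7 (by norm_num))
  have e8 := hF.nat 8 (hnat 8 (by norm_num))
  have f1 := hF.real 1 hreal
  constructor <;> (try rw [e0]) <;> (try rw [e1]) <;> (try rw [e2]) <;> (try rw [e3]) <;>
    (try rw [e4]) <;> (try rw [e5]) <;> (try rw [e6]) <;> (try rw [e7]) <;> (try rw [e8]) <;>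
    (try rw [f1]) <;> cases h <;> assumption

theorem Ready.setNat (h : Ready Y n d ℓ k m X col s) {a : ℕ} (ha : 8 < a) (i v : ℕ) :
    Ready Y n d ℓ k m X col (s.setNat a i v) :=
  h.frame (Exec.setNat s a (.const i) (.const v)).frame
    (fun b hb => by simp only [Program.writesNat, beq_eq_false_iff_ne]; omega) rfl

theorem Ready.setReal (h : Ready Y n d ℓ k m X col s) {a : ℕ} (ha : a ≠ 1) (i : ℕ) (v : ℝ) :
    Ready Y n d ℓ k m X col (s.setReal a i v) := by
  have e : (s.setReal a i v).real 1 = s.real 1 := s.setReal_real_of_ne ha.symm i v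
  constructor <;> (try rw [e]) <;> cases h <;> assumption

/-- Integer division: the quotient and the remainder are stored in the arrays `10` and `11`. -/
def divMod (p q : NatExpr) : Program :=
  .seq (.letNat 11 p) <| .seq (.letNat 10 (.const 0)) <|
    .while (.not (.natLT (.var 11) q)) <|
      .seq (.letNat 11 (.sub (.var 11) q)) (.letNat 10 (.add (.var 10) (.const 1)))

/-- The machine has no integer division. Repeated subtraction takes `u / v ≤ Y` rounds, so it counts
as one ordinary loop. -/
theorem runs_divMod {p q : NatExpr} {u v : ℕ} (hp : p.eval s = u)
    (hq : ∀ s', Frame (divMod p q) s s' → q.eval s' = v) (hv : 1 ≤ v) (hu : u ≤ Y) :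
    Runs Y d (divMod p q) s fun s' => s'.nat 10 0 = u / v ∧ s'.nat 11 0 = u % v := by
  refine .seq (.setNat (.seq (.setNat ?_)))
  refine (Runs.whileLoop (u / v) (fun i s' => Frame (divMod p q) s s' ∧ s'.nat 10 0 = i ∧
    s'.nat 11 0 = u - i * v) ?_ ?_ ?_ ?_).mono ?_
  · simpa [BoolExpr.isDimBound] using (Nat.div_le_self u v).trans hu
  · refine ⟨((Frame.refl _ _).setNat rfl _ _).setNat rfl _ _, by simp, by simp [hp]⟩
  · rintro i hi s' ⟨hF, h10, h11⟩
    have hle : (i + 1) * v ≤ u := (Nat.le_div_iff_mul_le hv).1 hi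
    rw [add_mul, one_mul] at hle
    refine ⟨by simp [hq s' hF, h11]; omega, .seq (.setNat (.setNat ⟨?_, ?_, ?_⟩))⟩
    · exact (hF.setNat rfl _ _).setNat rfl _ _
    · simp [h10]
    · simp [hq s' hF, h11, add_mul]; omega
  · rintro s' ⟨hF, h10, h11⟩
    simp [hq s' hF, h11]
    rw [mul_comm, ← Nat.mod_eq_sub]
    exact Nat.mod_lt _ hv
  · rintro s' - ⟨-, h10, h11⟩
    refine ⟨h10, by rw [h11, mul_comm, ← Nat.mod_eq_sub]⟩

/-- Conversion of the guess into the code of the colour classes and the sampled points. -/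
def decode : Program :=
  .seq (divMod (.var 9) (.var 4)) <| .seq (.letNat 12 (.var 11)) <| .seq (.letNat 13 (.var 10)) <|
    .forLoop 14 (.var 6) <| .seq (divMod (.var 13) nE) <| .seq (.setNat 15 (.var 14) (.var 11)) <|
      .letNat 13 (.var 10)

/-- A guess is a mixed-radix number: the lowest digit, in base `(n + 1) ^ k`, is the code, and the
following `k * m` digits, in base `n`, are the sampled points. -/
theorem runs_decode (h : Ready Y n d ℓ k m X col s) {x : ℕ} (hx : s.nat 9 0 = x) (hxY : x ≤ Y) :
    Runs Y d decode s fun s' => s'.nat 12 0 = x % (n + 1) ^ k ∧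
      ∀ u < k * m, s'.nat 15 u = x / (n + 1) ^ k / n ^ u % n := by
  refine .comp (runs_divMod (u := x) (v := (n + 1) ^ k) (by simp [hx])
    (fun s' hF => by simp [hF.nat 4 rfl, h.R_eq]) (Nat.one_le_pow _ _ (by omega)) hxY)
    fun s1 hF1 h1 => .seq (.setNat (.seq (.setNat ?_)))
  have r1 := h.frame hF1 (fun a ha => by interval_cases a <;> rfl) rfl
  refine .forLoop (k * m) (fun u s' => s'.nat 12 0 = x % (n + 1) ^ k ∧
    s'.nat 13 0 = x / (n + 1) ^ k / n ^ u ∧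
    ∀ u' < u, s'.nat 15 u' = x / (n + 1) ^ k / n ^ u' % n) h.km_le rfl ?_ ?_ ?_ ?_
  · intro s' hF
    simp [hF.nat 6 rfl, r1.km_eq]
  · simp [h1]
  · rintro u hu s2 hF2 hv ⟨i1, i2, i3⟩
    have e0 : s2.nat 0 0 = n := by rw [hF2.nat 0 rfl]; simp [r1.n_eq]
    refine .comp (runs_divMod (u := x / (n + 1) ^ k / n ^ u) (v := n) (by simp [i2])
      (fun s' hF => by simp [hF.nat 0 rfl, e0]) h.one_le_n
      (((Nat.div_le_self _ _).trans (Nat.div_le_self _ _)).trans hxY))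
      fun s3 hF3 h3 => .seq (.setNat (.setNat ?_))
    simp only [Memory.setNat_nat, NatExpr.eval]
    refine ⟨?_, ?_, ?_⟩
    · simp [hF3.nat 12 rfl, i1]
    · simp [h3.1, pow_succ, Nat.div_div_eq_div_mul, mul_assoc]
    · intro u' hu'
      rcases Nat.lt_succ_iff_lt_or_eq.1 hu' with hlt | rfl
      · simp [hF3.nat 15 rfl, hF3.nat 14 rfl, hv, hlt.ne, i3 u' hlt]
      · simp [hF3.nat 14 rfl, hv, h3.2]
  · rintro s' - ⟨i1, -, i3⟩
    exact ⟨i1, i3⟩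

/-- Coordinate `e` of the center `j`, which is the mean of the `m` sampled points
`dig (j * m), …, dig (j * m + m - 1)`. -/
noncomputable def meanCoord (X : ℕ → ℝ) (d m : ℕ) (dig : ℕ → ℕ) (j e : ℕ) : ℝ :=
  (∑ t ∈ Finset.range m, X (dig (j * m + t) * d + e)) / m

/-- Computes a coordinate of a center. -/
def meanProg : Program :=
  .seq (.letReal 3 (.cast (.const 0))) <| .seq
    (.forLoop 18 (.var 2) (.letReal 3 (.add (.var 3)
      (.get 1 (.add (.mul (.get 15 (.add (.mul (.var 16) (.var 2)) (.var 18))) dE) (.var 17))))))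
    (.letReal 3 (.div (.var 3) (.cast (.var 2))))

theorem runs_meanProg (h : Ready Y n d ℓ k m X col s) : Runs Y d meanProg s fun s' =>
    s'.real 3 0 = meanCoord X d m (s.nat 15) (s.nat 16 0) (s.nat 17 0) := by
  refine .seq (.setReal (.comp (R := fun s' => s'.real 3 0 = ∑ t ∈ Finset.range m,
    X (s.nat 15 (s.nat 16 0 * m + t) * d + s.nat 17 0)) ?_ ?_))
  · refine .forLoop m (fun i s' => s'.real 3 0 = ∑ t ∈ Finset.range i,
      X (s.nat 15 (s.nat 16 0 * m + t) * d + s.nat 17 0)) h.m_le rfl ?_ ?_ ?_ ?_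
    · intro s' hF
      simp [hF.nat 2 rfl, h.m_eq]
    · simp
    · intro i hi s' hF hv hI
      refine .setReal ?_
      simp [hF.nat 2 rfl, hF.nat 0 rfl, hF.nat 15 rfl, hF.nat 16 rfl, hF.nat 17 rfl,
        hF.real 1 rfl, h.m_eq, h.d_eq, h.point_eq, hv, hI, Finset.sum_range_succ]
    · exact fun s' _ h => h
  · intro s' hF hs
    refine .setReal ?_
    simp [hs, meanCoord, hF.nat 2 rfl, h.m_eq]

/-- The cost of a point as a function of its squared distance to the center. -/
noncomputable def Objective.weight (obj : Objective) (x : ℝ) : ℝ :=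
  match obj with
  | .kMeans => x
  | _ => √x

/-- The expression for the cost of a point. -/
def Objective.weightE (obj : Objective) (x : RealExpr) : RealExpr :=
  match obj with
  | .kMeans => x
  | _ => .sqrt x

@[simp] theorem Objective.eval_weightE (x : RealExpr) :
    (obj.weightE x).eval s = obj.weight (x.eval s) := by
  cases obj <;> rfl

theorem Objective.weight_nonneg {x : ℝ} (hx : 0 ≤ x) : 0 ≤ obj.weight x := by
  cases obj
  · exact Real.sqrt_nonneg x
  · exact hx
  · exact Real.sqrt_nonneg x

/-- The expression for the combination of two costs. -/
def Objective.opE (obj : Objective) (x y : RealExpr) : RealExpr :=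
  match obj with
  | .kCenter => .div (.add (.add x y) (.sqrt (.mul (.sub x y) (.sub x y)))) (.cast (.const 2))
  | _ => .add x y

-- For k-center the maximum is evaluated as `(x + y + |x - y|) / 2`, with the absolute value
-- obtained as the root of a square.
@[simp] theorem Objective.eval_opE (x y : RealExpr) :
    (obj.opE x y).eval s = obj.op (x.eval s) (y.eval s) := by
  cases obj
  · rfl
  · rfl
  · simp only [opE, op, RealExpr.eval, NatExpr.eval, Real.sqrt_mul_self_eq_abs, Nat.cast_ofNat]
    rcases le_total (x.eval s) (y.eval s) with h | h
    · rw [max_eq_right h, abs_of_nonpos (by linarith)]; ring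
    · rw [max_eq_left h, abs_of_nonneg (by linarith)]; ring

/-- The cost of assigning the point `i` to the center `j`. -/
noncomputable def pointWeight (obj : Objective) (X : ℕ → ℝ) (d m : ℕ) (dig : ℕ → ℕ) (i j : ℕ) : ℝ :=
  obj.weight (∑ e ∈ Finset.range d, (X (i * d + e) - meanCoord X d m dig j e) ^ 2)

theorem pointWeight_nonneg (dig : ℕ → ℕ) (i j : ℕ) : 0 ≤ pointWeight obj X d m dig i j :=
  Objective.weight_nonneg (Finset.sum_nonneg fun _ _ => sq_nonneg _)

/-- Computes the costs of all assignments of a point to a center. -/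
def weightProg (obj : Objective) : Program :=
  .forLoop 19 (.var 7) <| .seq (divMod (.var 19) kE) <| .seq (.letNat 16 (.var 11)) <|
    .seq (.letReal 5 (.cast (.const 0))) <| .seq
      (.forLoop 17 dE <| .seq meanProg <| .letReal 5 <| .add (.var 5) <|
        .mul (.sub (.get 1 (.add (.mul (.var 10) dE) (.var 17))) (.var 3))
          (.sub (.get 1 (.add (.mul (.var 10) dE) (.var 17))) (.var 3)))
      (.setReal 4 (.var 19) (obj.weightE (.var 5)))

theorem runs_weightProg (h : Ready Y n d ℓ k m X col s) : Runs Y d (weightProg obj) s fun s' =>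
    ∀ x < n * k, s'.real 4 x = pointWeight obj X d m (s.nat 15) (x / k) (x % k) := by
  refine .forLoop (n * k) (fun i s' => ∀ x < i, s'.real 4 x =
    pointWeight obj X d m (s.nat 15) (x / k) (x % k)) h.nk_le rfl ?_ ?_ ?_ ?_
  · intro s' hF
    simp [hF.nat 7 rfl, h.nk_eq]
  · simp
  · intro i hi s1 hF1 hv hI
    have r1 := h.frame hF1 (fun a ha => by interval_cases a <;> rfl) rfl
    refine .comp (runs_divMod (u := i) (v := k) (by simp [hv])
      (fun s' hF => by simp [hF.nat 0 rfl, r1.k_eq]) h.one_le_k (hi.le.trans h.nk_le))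
      fun s2 hF2 h2 => ?_
    have r2 := r1.frame hF2 (fun a ha => by interval_cases a <;> rfl) rfl
    refine .seq (.setNat (.seq (.setReal (.comp (R := fun s' => s'.real 5 0 =
      ∑ e ∈ Finset.range d, (X (i / k * d + e) -
        meanCoord X d m (s.nat 15) (i % k) e) ^ 2) ?_ ?_))))
    · refine .forLoop d (fun e' s' => s'.real 5 0 = ∑ e ∈ Finset.range e',
        (X (i / k * d + e) - meanCoord X d m (s.nat 15) (i % k) e) ^ 2) le_rfl rfl ?_ ?_ ?_ ?_
      · intro s' hF
        simp [hF.nat 0 rfl, r2.d_eq]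
      · simp
      · intro e he s3 hF3 hv3 hI3
        have r3 := ((r2.setNat (by norm_num) _ _).setReal (by norm_num) _ _).frame hF3
          (fun a ha => by interval_cases a <;> rfl) rfl
        refine .comp (runs_meanProg r3) fun s4 hF4 h4 => .setReal ?_
        simp [hF4.real 5 rfl, hI3, Finset.sum_range_succ, hF4.real 1 rfl, hF4.nat 10 rfl,
          hF4.nat 17 rfl, hF4.nat 0 rfl, r3.point_eq, r3.d_eq, hF3.nat 10 rfl, h2.1, hv3, h4,
          hF3.nat 15 rfl, hF3.nat 16 rfl, h2.2, Memory.setNat_nat_of_ne, hF2.nat 15 rfl,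
          hF1.nat 15 rfl, sq]
      · exact fun s' _ h => h
    · intro s3 hF3 h3
      refine .setReal ?_
      intro x hx
      have e19 : s3.nat 19 0 = i := by
        rw [hF3.nat 19 rfl]
        simp [hF2.nat 19 rfl, hv]
      rcases Nat.lt_succ_iff_lt_or_eq.1 hx with hlt | rfl
      · simp [e19, hlt.ne, hF3.real 4 rfl, hF2.real 4 rfl, hI x hlt]
      · simp [e19, h3, pointWeight]
  · exact fun s' _ h => h

end

/-! ### The dynamic program as code: table, reconstruction, all colour classes -/

section

variable {Y n d ℓ k m : ℕ} {X : ℕ → ℝ} {col : ℕ → ℕ} {s s' : Memory} {P : Program}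
  {obj : Objective} {w : ℕ → ℕ → ℝ}

/-- Equality of integers. -/
def BoolExpr.natEq (e f : NatExpr) : BoolExpr := .and (.not (.natLT e f)) (.not (.natLT f e))

@[simp] theorem BoolExpr.holds_natEq (e f : NatExpr) :
    (BoolExpr.natEq e f).Holds s ↔ e.eval s = f.eval s := by
  simp only [natEq, Holds]
  omega

/-- The innermost loop of the dynamic program: the entry with index `x + R`, where `x` is the
variable `19`, is minimized over all centers. -/
def cellProg (obj : Objective) : Program :=
  .forLoop 20 kE <| .ite
    (.and (.not (.natLT (.var 11) (.get 3 (.var 20))))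
      (.and (.not (.realLT (.get 6 (.sub (.var 19) (.get 3 (.var 20)))) (.cast (.const 0))))
        (.not (.and (.not (.realLT (.get 6 (.add (.var 19) (.var 4))) (.cast (.const 0))))
          (.not (.realLT (obj.opE (.get 6 (.sub (.var 19) (.get 3 (.var 20))))
            (.get 4 (.add (.mul (.var 10) kE) (.var 20)))) (.get 6 (.add (.var 19) (.var 4)))))))))
    (.seq (.setReal 6 (.add (.var 19) (.var 4))
        (obj.opE (.get 6 (.sub (.var 19) (.get 3 (.var 20))))
          (.get 4 (.add (.mul (.var 10) kE) (.var 20)))))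
      (.setNat 22 (.var 19) (.var 20)))
    .skip

/-- The entry starts out negative, that is infeasible, so the first usable center is always
accepted. -/
theorem runs_cellProg (h : Ready Y n d ℓ k m X col s)
    (hw : ∀ i < n, ∀ j < k, s.real 4 (i * k + j) = w i j) (hw0 : ∀ i j, 0 ≤ w i j) {x : ℕ}
    (hx : s.nat 19 0 = x) (hxn : x < n * (n + 1) ^ k) (hquo : s.nat 10 0 = x / (n + 1) ^ k)
    (hrem : s.nat 11 0 = x % (n + 1) ^ k) (hneg : s.real 6 (x + (n + 1) ^ k) < 0) :
    Runs Y d (cellProg obj) s fun s' =>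
      (∀ y, y ≠ x + (n + 1) ^ k → s'.real 6 y = s.real 6 y) ∧
      (∀ y, y ≠ x → s'.nat 22 y = s.nat 22 y) ∧
      CellCorrect obj w ((n + 1) ^ k) (fun j => (n + 1) ^ j) (s'.real 6) (s'.nat 22) k x := by
  have hR : 0 < (n + 1) ^ k := by positivity
  have hi : x / (n + 1) ^ k < n := Nat.div_lt_of_lt_mul (by rwa [mul_comm])
  refine .forLoop k (fun j s' =>
      (∀ y, y ≠ x + (n + 1) ^ k → s'.real 6 y = s.real 6 y) ∧
      (∀ y, y ≠ x → s'.nat 22 y = s.nat 22 y) ∧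
      CellCorrect obj w ((n + 1) ^ k) (fun j => (n + 1) ^ j) (s'.real 6) (s'.nat 22) j x)
    h.k_le rfl ?_ ?_ ?_ ?_
  · intro s' hF
    simp [hF.nat 0 rfl, h.k_eq]
  · exact ⟨fun _ _ => rfl, fun y _ => by simp, .inl ⟨hneg, by simp⟩⟩
  · rintro j hj s1 hF hv ⟨i1, i2, i3⟩
    have e19 : s1.nat 19 0 = x := by rw [hF.nat 19 rfl, hx]
    have e10 : s1.nat 10 0 = x / (n + 1) ^ k := by rw [hF.nat 10 rfl, hquo]
    have e11 : s1.nat 11 0 = x % (n + 1) ^ k := by rw [hF.nat 11 rfl, hrem]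
    have e4 : s1.nat 4 0 = (n + 1) ^ k := by rw [hF.nat 4 rfl, h.R_eq]
    have e3 : s1.nat 3 j = (n + 1) ^ j := by rw [hF.nat 3 rfl, h.pow_eq j hj]
    have e0 : s1.nat 0 3 = k := by rw [hF.nat 0 rfl, h.k_eq]
    have ew : s1.real 4 (x / (n + 1) ^ k * k + j) = w (x / (n + 1) ^ k) j := by
      rw [hF.real 4 rfl, hw _ hi j hj]
    refine .ite (fun hc => .seq (.setReal (.setNat ?_))) (fun hc => .skip ?_)
    · simp [e19, e10, e11, e4, e0, hv, e3, ew] at hc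
      refine ⟨fun y hy => ?_, fun y hy => ?_, ?_⟩
      · simp [e19, e4, hy, i1 y hy]
      · simp [e19, hy, i2 y hy]
      · refine CellCorrect.update hR (hw0 _ _) i3 ⟨hc.1, hc.2.1⟩ ?_ (fun y hy => ?_) ?_ ?_
        · exact or_iff_not_imp_left.2 fun h => hc.2.2 (not_lt.1 h)
        · simp [e19, e4, hy]
        · simp [e19, e10, e4, e0, hv, e3, ew]
        · simp [e19, hv]
    · simp only [Memory.setNat_real, Memory.setNat_nat_of_ne _ (show 22 ≠ 20 by norm_num)]
      refine ⟨i1, i2, i3.keep fun hu => hc ?_⟩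
      simp only [Usable] at hu
      simp [e19, e10, e11, e4, e0, hv, e3, ew]
      exact ⟨hu.1.1, hu.1.2, fun h => hu.2.resolve_left (not_lt.2 h)⟩
  · exact fun s' _ h => h

/-- The dynamic program for one colour. -/
def tableProg (obj : Objective) : Program :=
  .seq (.forLoop 19 (.var 4)
      (.setReal 6 (.var 19) (.sub (.cast (.const 0)) (.cast (.const 1))))) <|
    .seq (.setReal 6 (.const 0) (.cast (.const 0))) <|
      .forLoop 19 (.var 8) <| .seq (divMod (.var 19) (.var 4)) <|
        .ite (.natEq (.get 1 (.var 10)) (.var 21))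
          (.seq (.setReal 6 (.add (.var 19) (.var 4)) (.sub (.cast (.const 0)) (.cast (.const 1))))
            (cellProg obj))
          (.setReal 6 (.add (.var 19) (.var 4)) (.get 6 (.var 19)))

theorem runs_tableProg (h : Ready Y n d ℓ k m X col s)
    (hw : ∀ i < n, ∀ j < k, s.real 4 (i * k + j) = w i j) (hw0 : ∀ i j, 0 ≤ w i j) :
    Runs Y d (tableProg obj) s fun s' =>
      TableCorrect obj col w (s.nat 21 0) ((n + 1) ^ k) (fun j => (n + 1) ^ j) k
        (n * (n + 1) ^ k) (s'.real 6) (s'.nat 22) := by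
  have hR : 0 < (n + 1) ^ k := by positivity
  refine .comp (R := fun s' => ∀ r < (n + 1) ^ k, s'.real 6 r = -1) ?_ fun s1 hF1 h1 => ?_
  · refine .forLoop ((n + 1) ^ k) (fun i s' => ∀ r < i, s'.real 6 r = -1) h.R_le rfl ?_ ?_ ?_ ?_
    · intro s' hF
      simp [hF.nat 4 rfl, h.R_eq]
    · simp
    · intro i hi s' hF hv hI
      refine .setReal fun r hr => ?_
      rcases Nat.lt_succ_iff_lt_or_eq.1 hr with hlt | rfl
      · simp [hv, hI r hlt]
      · simp [hv]
    · exact fun s' _ h => h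
  · have r1 := h.frame hF1 (fun a ha => by interval_cases a <;> rfl) rfl
    refine .seq (.setReal ?_)
    refine .forLoop (n * (n + 1) ^ k) (fun N s' =>
      TableCorrect obj col w (s.nat 21 0) ((n + 1) ^ k) (fun j => (n + 1) ^ j) k
        N (s'.real 6) (s'.nat 22)) h.nR_le rfl ?_ ?_ ?_ ?_
    · intro s' hF
      simp [hF.nat 8 rfl, r1.nR_eq]
    · refine ⟨by simp, fun r h0 hr => ?_, by simp, by simp⟩
      simp [h0.ne', h1 r hr]
    · intro x hx s2 hF2 hv hI
      have r2 := (r1.setReal (by norm_num) _ _).frame hF2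
        (fun a ha => by interval_cases a <;> rfl) rfl
      refine .comp (runs_divMod (u := x) (v := (n + 1) ^ k) (by simp [hv])
        (fun s' hF => by simp [hF.nat 4 rfl, r2.R_eq]) hR (hx.le.trans h.nR_le))
        fun s3 hF3 h3 => ?_
      have r3 := r2.frame hF3 (fun a ha => by interval_cases a <;> rfl) rfl
      have e19 : s3.nat 19 0 = x := by rw [hF3.nat 19 rfl, hv]
      have e21 : s3.nat 21 0 = s.nat 21 0 := by
        rw [hF3.nat 21 rfl, hF2.nat 21 rfl]
        simp [hF1.nat 21 rfl]
      rw [← hF3.real 6 rfl, ← hF3.nat 22 rfl] at hI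
      refine .ite (fun hc => .seq (.setReal ?_)) (fun hc => .setReal ?_)
      · simp only [BoolExpr.holds_natEq, NatExpr.eval, h3.1, e21, r3.col_eq] at hc
        refine (runs_cellProg (obj := obj) (r3.setReal (by norm_num) _ _) ?_ hw0
          (x := x) e19 hx h3.1 h3.2 ?_).mono ?_
        · intro i hi j hj
          simp only [Memory.setReal_real_of_ne _ (show 4 ≠ 6 by norm_num)]
          rw [hF3.real 4 rfl, hF2.real 4 rfl]
          simp [hF1.real 4 rfl, hw i hi j hj]
        · simp [e19, r3.R_eq]
        · rintro s4 hF4 ⟨c1, c2, c3⟩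
          refine hI.succ hR (fun y hy => ?_) (fun y hy => ?_) (fun hne => absurd hc hne)
            (fun _ => ?_)
          · have hy' : y ≠ x + (n + 1) ^ k := hy.ne
            simp [c1 y hy', e19, r3.R_eq, hy']
          · simp [c2 y hy.ne]
          · simpa [Memory.setNat_nat_of_ne] using c3
      · simp only [BoolExpr.holds_natEq, NatExpr.eval, h3.1, e21, r3.col_eq] at hc
        refine hI.succ hR (fun y hy => ?_) (fun y hy => ?_) (fun _ => ?_)
            (fun he => absurd he hc)
        · simp [e19, r3.R_eq, hy.ne]
        · simp
        · simp [e19, r3.R_eq]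
    · exact fun s' _ h => h

/-- Reconstruction of an optimal assignment of the points of one colour. -/
def traceProg : Program :=
  .seq (.letNat 23 (.var 12)) <| .forLoop 26 nE <|
    .seq (.letNat 27 (.sub nE (.add (.var 26) (.const 1)))) <|
      .ite (.natEq (.get 1 (.var 27)) (.var 21))
        (.seq (.setNat 24 (.var 27) (.get 22 (.add (.mul (.var 27) (.var 4)) (.var 23))))
          (.letNat 23 (.sub (.var 23) (.get 3 (.get 24 (.var 27))))))
        .skip

theorem runs_traceProg (h : Ready Y n d ℓ k m X col s) {a r : ℕ} (ha : s.nat 21 0 = a)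
    (hr : s.nat 12 0 = r) (hrR : r < (n + 1) ^ k)
    (hT : TableCorrect obj col w a ((n + 1) ^ k) (fun j => (n + 1) ^ j) k
        (n * (n + 1) ^ k) (s.real 6) (s.nat 22)) (hnn : 0 ≤ s.real 6 (n * (n + 1) ^ k + r)) :
    Runs Y d traceProg s fun s' =>
      (∀ i < n, col i = a → s'.nat 24 i < k) ∧ (∀ i, col i ≠ a → s'.nat 24 i = s.nat 24 i) ∧
      classCode col (fun j => (n + 1) ^ j) a (s'.nat 24) n = r ∧
      classCost obj col w a (s'.nat 24) n = s.real 6 (n * (n + 1) ^ k + r) := by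
  refine .seq (.setNat ?_)
  refine .forLoop n (fun t s' => (∀ i, col i ≠ a → s'.nat 24 i = s.nat 24 i) ∧
    Traced obj col w a ((n + 1) ^ k) (fun j => (n + 1) ^ j) k n (s.real 6) r (n - t)
      (s'.nat 23 0) (s'.nat 24)) h.n_le rfl ?_ ?_ ?_ ?_
  · intro s' hF
    simp [hF.nat 0 rfl, h.n_eq]
  · refine ⟨by simp, ?_⟩
    simp [hr]
    exact Traced.init hrR hnn _
  · rintro t ht s1 hF hv ⟨i1, i2⟩
    have r1 := (h.setNat (by norm_num) _ _).frame hF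
        (fun a ha => by interval_cases a <;> rfl) rfl
    have e21 : s1.nat 21 0 = a := by rw [hF.nat 21 rfl]; simp [ha]
    have e22 : s1.nat 22 = s.nat 22 := by
      rw [hF.nat 22 rfl, Memory.setNat_nat_of_ne _ (by norm_num)]
    -- The loop counts up while the points are treated in descending order: round `t` handles the
    -- point `n - (t + 1)`.
    have hsucc : n - t = n - (t + 1) + 1 := by omega
    rw [hsucc] at i2
    refine .seq (.setNat (.ite (fun hc => .seq (.setNat (.setNat ?_))) (fun hc => .skip ?_)))
    · simp [r1.n_eq, hv, e21, r1.col_eq] at hc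
      set i := n - (t + 1) with hi
      set rc := s1.nat 23 0 with hrc
      have key := i2.step hT (σ' := Function.update (s1.nat 24) i
        (s.nat 22 (i * (n + 1) ^ k + rc))) (by omega) hc (by simp)
        (fun i' hi' => by simp [hi'])
      have hlt := key.center_lt i (by omega) le_rfl hc
      simp only [Function.update_self] at hlt
      have hfun : ((((s1.setNat 27 0 i).setNat 24 i (s.nat 22 (i * (n + 1) ^ k + rc))).setNat 23 0
          (rc - (n + 1) ^ s.nat 22 (i * (n + 1) ^ k + rc))).setNat 26 0 (t + 1)).nat 24 =
          Function.update (s1.nat 24) i (s.nat 22 (i * (n + 1) ^ k + rc)) := by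
        funext y
        simp [Function.update_apply]
      simp [r1.n_eq, hv, ← hi, r1.R_eq, e22, ← hrc, r1.pow_eq _ hlt]
      rw [hfun]
      refine ⟨fun i' hi' => ?_, key⟩
      have : i' ≠ i := by rintro rfl; exact hi' hc
      simp [this, i1 i' hi']
    · simp [r1.n_eq, hv, e21, r1.col_eq] at hc
      simp [r1.n_eq, hv, Memory.setNat_nat_of_ne]
      exact ⟨i1, i2.skip hT (by omega) hc⟩
  · rintro s' hF ⟨i1, i2⟩
    rw [Nat.sub_self] at i2
    exact ⟨fun i hi hc => i2.center_lt i hi (Nat.zero_le _) hc, i1, i2.final hT⟩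

/-- The assignment `τ` of the points to `k` centers gives the code `r` to every colour class. -/
def ValidAssignment (n ℓ k : ℕ) (col : ℕ → ℕ) (r : ℕ) (τ : ℕ → ℕ) : Prop :=
  (∀ i < n, τ i < k) ∧ ∀ a < ℓ, classCode col (fun j => (n + 1) ^ j) a τ n = r

/-- Computes an optimal assignment with a given code of the colour classes. -/
def classProg (obj : Objective) : Program :=
  .seq (.letNat 25 (.const 1)) <| .forLoop 21 lE <| .seq (tableProg obj) <|
    .ite (.realLT (.get 6 (.add (.var 8) (.var 12))) (.cast (.const 0)))
      (.letNat 25 (.const 0)) traceProg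

/-- For a fixed code the constraints on different colours are independent, so class-wise optima
combine to a global optimum. Each reconstruction leaves the other colours' entries in the array `24`
untouched; one infeasible colour clears the flag for good. -/
theorem runs_classProg (h : Ready Y n d ℓ k m X col s) (hcol : ∀ i < n, col i < ℓ)
    (hw : ∀ i < n, ∀ j < k, s.real 4 (i * k + j) = w i j) (hw0 : ∀ i j, 0 ≤ w i j) {r : ℕ}
    (hr : s.nat 12 0 = r) (hrR : r < (n + 1) ^ k) :
    Runs Y d (classProg obj) s fun s' =>
      (s'.nat 25 0 = 0 ∧ ∀ τ, ¬ ValidAssignment n ℓ k col r τ) ∨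
      (s'.nat 25 0 = 1 ∧ ValidAssignment n ℓ k col r (s'.nat 24) ∧
        ∀ τ, ValidAssignment n ℓ k col r τ →
          obj.total (fun i => w i (s'.nat 24 i)) n ≤ obj.total (fun i => w i (τ i)) n) := by
  refine .seq (.setNat ?_)
  refine .forLoop ℓ (fun a s' => (s'.nat 25 0 = 0 ∧ ∀ τ, ¬ ValidAssignment n ℓ k col r τ) ∨
      (s'.nat 25 0 = 1 ∧ ∀ a' < a, (∀ i < n, col i = a' → s'.nat 24 i < k) ∧
        classCode col (fun j => (n + 1) ^ j) a' (s'.nat 24) n = r ∧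
        ∀ τ, ValidAssignment n ℓ k col r τ →
          classCost obj col w a' (s'.nat 24) n ≤ classCost obj col w a' τ n))
    (h.l_le.trans h.n_le) rfl ?_ ?_ ?_ ?_
  · intro s' hF
    simp [hF.nat 0 rfl, h.l_eq]
  · exact .inr ⟨by simp, by simp⟩
  · intro a ha s1 hF1 hv hI
    have r1 := (h.setNat (by norm_num) _ _).frame hF1
        (fun a ha => by interval_cases a <;> rfl) rfl
    have hw1 : ∀ i < n, ∀ j < k, s1.real 4 (i * k + j) = w i j := by
      intro i hi j hj
      rw [hF1.real 4 rfl]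
      exact hw i hi j hj
    refine .comp (runs_tableProg r1 hw1 hw0) fun s2 hF2 hT => ?_
    have r2 := r1.frame hF2 (fun a ha => by interval_cases a <;> rfl) rfl
    rw [hv] at hT
    have e12 : s2.nat 12 0 = r := by
      rw [hF2.nat 12 rfl, hF1.nat 12 rfl]
      simp [hr]
    have e21 : s2.nat 21 0 = a := by rw [hF2.nat 21 rfl, hv]
    have hopt : ∀ τ, ValidAssignment n ℓ k col r τ →
        0 ≤ s2.real 6 (n * (n + 1) ^ k + r) ∧
          s2.real 6 (n * (n + 1) ^ k + r) ≤ classCost obj col w a τ n := by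
      intro τ hτ
      have := hT.optimal (n := n) hτ.1 n le_rfl (by rw [hτ.2 a ha]; exact hrR)
      rwa [hτ.2 a ha] at this
    refine .ite (fun hc => .setNat (.inl ⟨by simp, fun τ hτ => ?_⟩)) (fun hc => ?_)
    · simp [r2.nR_eq, e12] at hc
      exact absurd (hopt τ hτ).1 (not_le.2 hc)
    · simp [r2.nR_eq, e12] at hc
      refine (runs_traceProg r2 e21 e12 hrR hT hc).mono ?_
      rintro s3 hF3 ⟨t1, t2, t3, t4⟩
      have e25 : s3.nat 25 0 = s1.nat 25 0 := by rw [hF3.nat 25 rfl, hF2.nat 25 rfl]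
      have e24 : (s3.setNat 21 0 (a + 1)).nat 24 = s3.nat 24 :=
        s3.setNat_nat_of_ne (by norm_num) _ _
      rw [e24]
      simp only [Memory.setNat_nat]
      norm_num
      rw [e25]
      refine hI.imp id fun hI => ⟨hI.1, fun a' ha' => ?_⟩
      rcases ha'.lt_or_eq with hlt | rfl
      · have hsame : ∀ i < n, col i = a' → s3.nat 24 i = s1.nat 24 i := by
          intro i hi hc
          rw [t2 i (by omega), hF2.nat 24 rfl]
        rw [classCode_congr hsame, classCost_congr hsame]
        refine ⟨fun i hi hc => ?_, (hI.2 a' hlt).2⟩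
        rw [hsame i hi hc]
        exact (hI.2 a' hlt).1 i hi hc
      · exact ⟨t1, t3, fun τ hτ => t4 ▸ (hopt τ hτ).2⟩
  · intro s' hF hI
    refine hI.imp id fun hI => ⟨hI.1, ⟨fun i hi => (hI.2 _ (hcol i hi)).1 i hi rfl,
      fun a ha => (hI.2 a ha).2.1⟩, fun τ hτ => ?_⟩
    exact obj.total_le_of_classes hcol (fun i _ => hw0 _ _) fun a ha => (hI.2 a ha).2.2 τ hτ

end

/-! ### Cost, output and exhaustive search -/

section

variable {Y n d ℓ k m : ℕ} {X : ℕ → ℝ} {col : ℕ → ℕ} {s s' : Memory} {P : Program}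
  {obj : Objective} {w : ℕ → ℕ → ℝ}

/-- Computes the cost of the current assignment. -/
def totalProg (obj : Objective) : Program :=
  .seq (.letReal 7 (.cast (.const 0))) <| .forLoop 28 nE <|
    .letReal 7 (obj.opE (.var 7) (.get 4 (.add (.mul (.var 28) kE) (.get 24 (.var 28)))))

theorem runs_totalProg (h : Ready Y n d ℓ k m X col s) :
    Runs Y d (totalProg obj) s fun s' =>
      s'.real 7 0 = obj.total (fun i => s.real 4 (i * k + s.nat 24 i)) n := by
  refine .seq (.setReal ?_)
  refine .forLoop n (fun i' s' => s'.real 7 0 =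
    obj.total (fun i => s.real 4 (i * k + s.nat 24 i)) i') h.n_le rfl ?_ ?_ ?_ ?_
  · intro s' hF
    simp [hF.nat 0 rfl, h.n_eq]
  · simp [Objective.total]
  · intro i hi s' hF hv hI
    refine .setReal ?_
    simp [hI, Objective.total, hv, hF.nat 0 rfl, h.k_eq, hF.nat 24 rfl, hF.real 4 rfl]
  · exact fun s' _ h => h

/-- Writes the centers of the current assignment to the output. -/
def outputProg : Program :=
  .forLoop 30 nE <| .seq (.letNat 16 (.get 24 (.var 30))) <| .forLoop 17 dE <|
    .seq meanProg (.setReal 2 (.add (.mul (.var 30) dE) (.var 17)) (.var 3))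

theorem runs_outputProg (h : Ready Y n d ℓ k m X col s) :
    Runs Y d outputProg s fun s' => ∀ i < n, ∀ e < d,
      s'.real 2 (i * d + e) = meanCoord X d m (s.nat 15) (s.nat 24 i) e := by
  refine .forLoop n (fun i' s' => ∀ i < i', ∀ e < d,
      s'.real 2 (i * d + e) = meanCoord X d m (s.nat 15) (s.nat 24 i) e) h.n_le rfl ?_ ?_ ?_ ?_
  · intro s' hF
    simp [hF.nat 0 rfl, h.n_eq]
  · simp
  · intro i hi s1 hF1 hv1 hI1
    have r1 := h.frame hF1 (fun a ha => by interval_cases a <;> rfl) rfl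
    refine .seq (.setNat ?_)
    refine .forLoop d (fun e' s' => (∀ i' < i, ∀ e < d,
      s'.real 2 (i' * d + e) = meanCoord X d m (s.nat 15) (s.nat 24 i') e) ∧ ∀ e < e',
      s'.real 2 (i * d + e) = meanCoord X d m (s.nat 15) (s.nat 24 i) e) le_rfl rfl ?_ ?_ ?_ ?_
    · intro s' hF
      simp [hF.nat 0 rfl, r1.d_eq]
    · simpa using hI1
    · rintro e he s2 hF2 hv2 ⟨hI2, hI3⟩
      have r2 := (r1.setNat (by norm_num) _ _).frame hF2
        (fun a ha => by interval_cases a <;> rfl) rfl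
      refine .comp (runs_meanProg r2) fun s3 hF3 h3 => .setReal ?_
      have e30 : s3.nat 30 0 = i := by
        rw [hF3.nat 30 rfl, hF2.nat 30 rfl]
        simp [hv1]
      have e17 : s3.nat 17 0 = e := by rw [hF3.nat 17 rfl, hv2]
      have e0 : s3.nat 0 1 = d := by rw [hF3.nat 0 rfl, r2.d_eq]
      have e16 : s2.nat 16 0 = s.nat 24 i := by
        rw [hF2.nat 16 rfl]
        simp [hv1, hF1.nat 24 rfl]
      have e15 : s2.nat 15 = s.nat 15 := by
        rw [hF2.nat 15 rfl, Memory.setNat_nat_of_ne _ (by norm_num), hF1.nat 15 rfl]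
      refine ⟨fun i' hi' e' he' => ?_, fun e' he' => ?_⟩
      · have : i' * d + e' ≠ i * d + e := by
          have : (i' + 1) * d ≤ i * d := Nat.mul_le_mul_right _ hi'
          rw [add_mul, one_mul] at this
          omega
        simp [e30, e17, e0, this, hF3.real 2 rfl, hI2 i' hi' e' he']
      · rcases Nat.lt_succ_iff_lt_or_eq.1 he' with hlt | rfl
        · simp [e30, e17, e0, hlt.ne, hF3.real 2 rfl, hI3 e' hlt]
        · simp [e30, e17, e0, h3, e16, e15, hv2]
    · rintro s' hF ⟨hI2, hI3⟩ i' hi'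
      rcases Nat.lt_succ_iff_lt_or_eq.1 hi' with hlt | rfl
      · exact hI2 i' hlt
      · exact hI3
  · exact fun s' _ h => h

/-- The sampled points that belong to the guess `x`. -/
def guessDigit (n k x u : ℕ) : ℕ := x / (n + 1) ^ k / n ^ u % n

/-- The code of the colour classes that belongs to the guess `x`. -/
def guessCode (n k x : ℕ) : ℕ := x % (n + 1) ^ k

/-- The cost of an assignment for the guess `x`. -/
noncomputable def guessCost (obj : Objective) (X : ℕ → ℝ) (n d k m x : ℕ) (τ : ℕ → ℕ) : ℝ :=
  obj.total (fun i => pointWeight obj X d m (guessDigit n k x) i (τ i)) n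

/-- The output consists of the centers of an optimal assignment for some guess, and this
assignment is optimal among all assignments for guesses below `N`. -/
def BestOutput (obj : Objective) (X : ℕ → ℝ) (col : ℕ → ℕ) (n d ℓ k m N : ℕ) (out : ℕ → ℝ)
    (best : ℝ) : Prop :=
  ∃ x σ, ValidAssignment n ℓ k col (guessCode n k x) σ ∧ best = guessCost obj X n d k m x σ ∧
    (∀ i < n, ∀ e < d, out (i * d + e) = meanCoord X d m (guessDigit n k x) (σ i) e) ∧
    ∀ y < N, ∀ τ, ValidAssignment n ℓ k col (guessCode n k y) τ →
      best ≤ guessCost obj X n d k m y τ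

/-- Updates the output by the current assignment. -/
def updateProg : Program :=
  .ite (.and (.natLT (.const 0) (.var 25))
      (.not (.and (.natLT (.const 0) (.var 29)) (.not (.realLT (.var 7) (.var 8))))))
    (.seq (.letReal 8 (.var 7)) <| .seq (.letNat 29 (.const 1)) outputProg) .skip

/-- Tries all guesses. -/
def searchProg (obj : Objective) : Program :=
  .seq (.letNat 29 (.const 0)) <| .forLoop 9 (.var 5) <| .seq decode <| .seq (weightProg obj) <|
    .seq (classProg obj) <| .seq (totalProg obj) updateProg

theorem meanCoord_congr {dig dig' : ℕ → ℕ} (h : ∀ u < k * m, dig u = dig' u) {j : ℕ} (hj : j < k)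
    (e : ℕ) : meanCoord X d m dig j e = meanCoord X d m dig' j e := by
  unfold meanCoord
  congr 1
  refine Finset.sum_congr rfl fun t ht => ?_
  rw [h]
  have : (j + 1) * m ≤ k * m := Nat.mul_le_mul_right _ hj
  rw [add_mul, one_mul] at this
  have := Finset.mem_range.1 ht
  omega

theorem runs_searchProg (h : Ready Y n d ℓ k m X col s) (hcol : ∀ i < n, col i < ℓ) :
    Runs Y d (searchProg obj) s fun s' =>
      (∀ x < (n + 1) ^ k * n ^ (k * m), ∀ τ, ¬ ValidAssignment n ℓ k col (guessCode n k x) τ) ∨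
      BestOutput obj X col n d ℓ k m ((n + 1) ^ k * n ^ (k * m)) (s'.real 2) (s'.real 8 0) := by
  have hR : 0 < (n + 1) ^ k := by positivity
  refine .seq (.setNat ?_)
  refine .forLoop ((n + 1) ^ k * n ^ (k * m)) (fun N s' =>
      (s'.nat 29 0 = 0 ∧ ∀ x < N, ∀ τ, ¬ ValidAssignment n ℓ k col (guessCode n k x) τ) ∨
      (s'.nat 29 0 = 1 ∧ BestOutput obj X col n d ℓ k m N (s'.real 2) (s'.real 8 0)))
    h.guess_le rfl ?_ ?_ ?_ ?_
  · intro s' hF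
    simp [hF.nat 5 rfl, h.guess_eq]
  · exact .inl ⟨by simp, by simp⟩
  · intro x hx s1 hF1 hv hI
    have r1 := (h.setNat (by norm_num) _ _).frame hF1
        (fun a ha => by interval_cases a <;> rfl) rfl
    refine .comp (runs_decode r1 hv (hx.le.trans h.guess_le)) fun s2 hF2 h2 => ?_
    have r2 := r1.frame hF2 (fun a ha => by interval_cases a <;> rfl) rfl
    refine .comp (runs_weightProg r2) fun s3 hF3 h3 => ?_
    have r3 := r2.frame hF3 (fun a ha => by interval_cases a <;> rfl) rfl
    have hdig : ∀ u < k * m, s2.nat 15 u = guessDigit n k x u := h2.2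
    have hmean : ∀ j < k, ∀ e, meanCoord X d m (s2.nat 15) j e =
        meanCoord X d m (guessDigit n k x) j e := fun j hj e => meanCoord_congr hdig hj e
    have hw3 : ∀ i < n, ∀ j < k, s3.real 4 (i * k + j) =
        pointWeight obj X d m (guessDigit n k x) i j := by
      intro i hi j hj
      have hlt : i * k + j < n * k := by nlinarith
      have hdiv : (i * k + j) / k = i := by
        rw [mul_comm, Nat.mul_add_div (by omega), Nat.div_eq_of_lt hj, add_zero]
      have hmod : (i * k + j) % k = j := by
        rw [mul_comm, Nat.mul_add_mod, Nat.mod_eq_of_lt hj]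
      rw [h3 _ hlt, hdiv, hmod]
      simp only [pointWeight, hmean j hj]
    refine .comp (runs_classProg (r := guessCode n k x) r3 hcol hw3
      (fun i j => pointWeight_nonneg _ _ _)
      (by rw [hF3.nat 12 rfl, h2.1]; rfl) (Nat.mod_lt _ hR)) fun s4 hF4 h4 => ?_
    have r4 := r3.frame hF4 (fun a ha => by interval_cases a <;> rfl) rfl
    refine .comp (runs_totalProg r4) fun s5 hF5 h5 => ?_
    have r5 := r4.frame hF5 (fun a ha => by interval_cases a <;> rfl) rfl
    have e29 : s5.nat 29 0 = s1.nat 29 0 := by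
      rw [hF5.nat 29 rfl, hF4.nat 29 rfl, hF3.nat 29 rfl, hF2.nat 29 rfl]
    have f8 : s5.real 8 0 = s1.real 8 0 := by
      rw [hF5.real 8 rfl, hF4.real 8 rfl, hF3.real 8 rfl, hF2.real 8 rfl]
    have f2 : s5.real 2 = s1.real 2 := by
      rw [hF5.real 2 rfl, hF4.real 2 rfl, hF3.real 2 rfl, hF2.real 2 rfl]
    have e15 : s5.nat 15 = s2.nat 15 := by
      rw [hF5.nat 15 rfl, hF4.nat 15 rfl, hF3.nat 15 rfl]
    have e25 : s5.nat 25 0 = s4.nat 25 0 := by rw [hF5.nat 25 rfl]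
    have e24 : s5.nat 24 = s4.nat 24 := hF5.nat 24 rfl
    rw [← e29, ← f8, ← f2] at hI
    rw [← e25, ← e24] at h4
    -- `totalProg` runs even if no valid assignment was found; its result is meaningful only under
    -- this hypothesis.
    have htot : ValidAssignment n ℓ k col (guessCode n k x) (s5.nat 24) →
        s5.real 7 0 = guessCost obj X n d k m x (s5.nat 24) := by
      intro hval
      rw [h5]
      refine obj.total_congr fun i hi => ?_
      rw [hF4.real 4 rfl, ← e24, hw3 i hi _ (hval.1 i hi)]
    refine .ite (fun hc => .seq (.setReal (.seq (.setNat ?_)))) (fun hc => .skip ?_)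
    · simp at hc
      rcases h4 with h4 | ⟨-, hval, hopt⟩
      · omega
      refine (runs_outputProg ((r5.setReal (by norm_num) _ _).setNat (by norm_num) _ _)).mono
        fun s6 hF6 h6 => .inr ⟨?_, x, s5.nat 24, hval, ?_, ?_, ?_⟩
      · simp [hF6.nat 29 rfl]
      · simp [hF6.real 8 rfl, htot hval]
      · intro i hi e he
        have := h6 i hi e he
        rw [Memory.setNat_nat_of_ne _ (by norm_num), Memory.setNat_nat_of_ne _ (by norm_num)]
          at this
        simp only [Memory.setReal_nat, Memory.setNat_real] at this ⊢
        rw [this, e15, hmean _ (hval.1 i hi)]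
      · intro y hy τ hτ
        have e : (s6.setNat 9 0 (x + 1)).real 8 0 = s5.real 7 0 := by
          simp [hF6.real 8 rfl]
        rw [e]
        rcases Nat.lt_succ_iff_lt_or_eq.1 hy with hlt | rfl
        · rcases hI with hI | ⟨hI1, hI2⟩
          · exact absurd hτ (hI.2 y hlt τ)
          · obtain ⟨_, _, _, _, _, hb⟩ := hI2
            exact (hc.2 (by omega)).le.trans (hb y hlt τ hτ)
        · rw [htot hval]
          exact hopt τ hτ
    · simp at hc
      have e29' : (s5.setNat 9 0 (x + 1)).nat 29 0 = s5.nat 29 0 := by simp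
      rw [e29']
      simp only [Memory.setNat_real]
      rcases h4 with ⟨-, hno⟩ | ⟨h25, hval, hopt⟩
      · refine hI.imp (fun hI => ⟨hI.1, fun y hy => ?_⟩) (fun hI => ⟨hI.1, ?_⟩)
        · rcases Nat.lt_succ_iff_lt_or_eq.1 hy with hlt | rfl
          · exact hI.2 y hlt
          · exact hno
        · obtain ⟨x', σ, b1, b2, b3, b4⟩ := hI.2
          refine ⟨x', σ, b1, b2, b3, fun y hy τ hτ => ?_⟩
          rcases Nat.lt_succ_iff_lt_or_eq.1 hy with hlt | rfl
          · exact b4 y hlt τ hτ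
          · exact absurd hτ (hno τ)
      · obtain ⟨h29, hle⟩ := hc (by omega)
        rcases hI with hI | ⟨hI1, x', σ, b1, b2, b3, b4⟩
        · omega
        · refine .inr ⟨hI1, x', σ, b1, b2, b3, fun y hy τ hτ => ?_⟩
          rcases Nat.lt_succ_iff_lt_or_eq.1 hy with hlt | rfl
          · exact b4 y hlt τ hτ
          · exact (hle.trans_eq (htot hval)).trans (hopt τ hτ)
  · exact fun s' _ hI => hI.imp And.right And.right

/-! ### Setup of the loop bounds and the complete program -/

/-- Computes the sample size. -/
def sizeProg : Program :=
  .seq (.letNat 2 (.const 0)) <|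
    .while (.realLT (.mul (.cast (.var 2)) (.mul (.var 0) (.var 0))) (.cast (.const 1)))
      (.letNat 2 (.add (.var 2) (.const 1)))

/-- The sample size. -/
noncomputable def sampleSize (ε : ℝ) : ℕ := ⌈1 / (ε * ε)⌉₊

/-- There is no rounding operation, so the ceiling of `1 / ε²` is found by counting up until `m * ε²
≥ 1`. -/
theorem runs_sizeProg {ε : ℝ} (hε : 0 < ε) (hs : s.real 0 0 = ε) (hm : sampleSize ε ≤ Y) :
    Runs Y d sizeProg s fun s' => s'.nat 2 0 = sampleSize ε := by
  have hpos : 0 < ε * ε := by positivity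
  refine .seq (.setNat ?_)
  refine (Runs.whileLoop (sampleSize ε) (fun i s' => s'.real 0 0 = ε ∧ s'.nat 2 0 = i)
    ?_ ⟨by simp [hs], by simp⟩ ?_ ?_).mono fun s' _ h => h.2
  · exact hm
  · rintro i hi s' ⟨h0, h2⟩
    refine ⟨?_, .setNat ⟨by simp [h0], by simp [h2]⟩⟩
    simp [h0, h2]
    exact (lt_div_iff₀ hpos).1 (Nat.lt_ceil.1 hi)
  · rintro s' ⟨h0, h2⟩
    simp [h0, h2]
    exact (div_le_iff₀ hpos).1 (Nat.le_ceil _)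

/-- Computes the powers of `n + 1`. -/
def powProg : Program :=
  .seq (.setNat 3 (.const 0) (.const 1)) <| .forLoop 20 kE <|
    .setNat 3 (.add (.var 20) (.const 1)) (.mul (.get 3 (.var 20)) (.add nE (.const 1)))

theorem runs_powProg (hk : s.nat 0 3 = k) (hn : s.nat 0 0 = n) (hkY : k ≤ Y) :
    Runs Y d powProg s fun s' => ∀ j ≤ k, s'.nat 3 j = (n + 1) ^ j := by
  refine .seq (.setNat ?_)
  refine .forLoop k (fun i s' => ∀ j ≤ i, s'.nat 3 j = (n + 1) ^ j) hkY rfl ?_ ?_ ?_ ?_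
  · intro s' hF
    simp [hF.nat 0 rfl, hk]
  · simp
  · intro i hi s' hF hv hI
    refine .setNat fun j hj => ?_
    rcases hj.lt_or_eq with hlt | rfl
    · simp [hv, hlt.ne, hI j (by omega)]
    · simp [hv, hI i le_rfl, hF.nat 0 rfl, hn, pow_succ]
  · exact fun s' _ h => h

/-- Computes the numbers that bound the loops. -/
def setupProg : Program :=
  .seq sizeProg <| .seq powProg <| .seq (.letNat 4 (.get 3 kE)) <|
    .seq (.letNat 6 (.mul kE (.var 2))) <| .seq (.letNat 7 (.mul nE kE)) <|
      .seq (.letNat 8 (.mul nE (.var 4))) <| .seq (.letNat 5 (.var 4)) <|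
        .forLoop 20 (.var 6) (.letNat 5 (.mul (.var 5) nE))

theorem runs_setupProg {ε : ℝ} (hε : 0 < ε) (hs : s.real 0 0 = ε) (hn : s.nat 0 0 = n)
    (hd : s.nat 0 1 = d) (hl : s.nat 0 2 = ℓ) (hk : s.nat 0 3 = k) (hcol : s.nat 1 = col)
    (hX : s.real 1 = X) (hn1 : 1 ≤ n) (hk1 : 1 ≤ k) (hln : ℓ ≤ n) (n_le : n ≤ Y) (k_le : k ≤ Y)
    (m_le : sampleSize ε ≤ Y) (R_le : (n + 1) ^ k ≤ Y)
    (guess_le : (n + 1) ^ k * n ^ (k * sampleSize ε) ≤ Y) (km_le : k * sampleSize ε ≤ Y)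
    (nk_le : n * k ≤ Y) (nR_le : n * (n + 1) ^ k ≤ Y) :
    Runs Y d setupProg s (Ready Y n d ℓ k (sampleSize ε) X col) := by
  refine .comp (runs_sizeProg hε hs m_le) fun s1 hF1 h1 => ?_
  refine .comp (runs_powProg (k := k) (n := n) (by rw [hF1.nat 0 rfl, hk])
    (by rw [hF1.nat 0 rfl, hn]) k_le) fun s2 hF2 h2 => ?_
  have g0 : s2.nat 0 = s.nat 0 := by rw [hF2.nat 0 rfl, hF1.nat 0 rfl]
  have g1 : s2.nat 1 = col := by rw [hF2.nat 1 rfl, hF1.nat 1 rfl, hcol]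
  have g2 : s2.nat 2 0 = sampleSize ε := by rw [hF2.nat 2 rfl, h1]
  have f1 : s2.real 1 = X := by rw [hF2.real 1 rfl, hF1.real 1 rfl, hX]
  refine .seq (.setNat (.seq (.setNat (.seq (.setNat (.seq (.setNat (.seq (.setNat ?_)))))))))
  refine .forLoop (k * sampleSize ε) (fun i s' => s'.nat 5 0 = (n + 1) ^ k * n ^ i) km_le rfl
    ?_ ?_ ?_ ?_
  · intro s' hF
    simp [hF.nat 6 rfl, g0, hk, g2]
  · simp [g0, hk, h2]
  · intro i hi s' hF hv hI
    refine .setNat ?_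
    simp [hI, hF.nat 0 rfl, g0, hn, pow_succ, mul_assoc]
  · intro s' hF hI
    exact {
      n_eq := by rw [hF.nat 0 rfl]; simp [g0, hn]
      d_eq := by rw [hF.nat 0 rfl]; simp [g0, hd]
      l_eq := by rw [hF.nat 0 rfl]; simp [g0, hl]
      k_eq := by rw [hF.nat 0 rfl]; simp [g0, hk]
      col_eq := by rw [hF.nat 1 rfl]; simp [Memory.setNat_nat_of_ne, g1]
      point_eq := by rw [hF.real 1 rfl]; simp [f1]
      m_eq := by rw [hF.nat 2 rfl]; simp [g2]
      pow_eq := fun j hj => by rw [hF.nat 3 rfl]; simp [h2 j hj.le]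
      R_eq := by rw [hF.nat 4 rfl]; simp [g0, hk, h2]
      guess_eq := hI
      km_eq := by rw [hF.nat 6 rfl]; simp [g0, hk, g2]
      nk_eq := by rw [hF.nat 7 rfl]; simp [g0, hk, hn]
      nR_eq := by rw [hF.nat 8 rfl]; simp [g0, hk, hn, h2]
      one_le_n := hn1
      one_le_k := hk1
      l_le := hln
      n_le := n_le
      k_le := k_le
      m_le := m_le
      R_le := R_le
      guess_le := guess_le
      km_le := km_le
      nk_le := nk_le
      nR_le := nR_le }

/-- Copies the first point to the output. -/
def copyProg : Program := .forLoop 17 dE (.setReal 2 (.var 17) (.get 1 (.var 17)))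

theorem runs_copyProg (hd : s.nat 0 1 = d) :
    Runs Y d copyProg s fun s' => ∀ e < d, s'.real 2 e = s.real 1 e := by
  refine .forLoop d (fun i s' => ∀ e < i, s'.real 2 e = s.real 1 e) le_rfl rfl ?_ ?_ ?_ ?_
  · intro s' hF
    simp [hF.nat 0 rfl, hd]
  · simp
  · intro i hi s' hF hv hI
    refine .setReal fun e he => ?_
    rcases Nat.lt_succ_iff_lt_or_eq.1 he with hlt | rfl
    · simp [hv, hlt.ne, hI e hlt]
    · simp [hv, hF.real 1 rfl]
  · exact fun s' _ h => h

/-- The approximation scheme. -/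
def clusterProg (obj : Objective) : Program :=
  .ite (.natLT (.const 1) nE)
    (.ite (.natLT nE lE) .skip (.seq setupProg (searchProg obj))) copyProg

theorem clusterProg_dimDepth : (clusterProg obj).dimDepth = 1 := rfl

/-- Depth four is reached by the loops over guesses, colours, table cells and centers. -/
theorem clusterProg_depth : (clusterProg obj).depth = 4 := rfl

end

/-! ### Means of few points as approximate centers -/

section

open scoped InnerProductSpace

variable {E ι : Type*} [NormedAddCommGroup E] [InnerProductSpace ℝ E]

/-- The mean of the points `x (g 0), …, x (g (m - 1))`. -/
noncomputable def sampleMean (x : ι → E) (m : ℕ) (g : ℕ → ι) : E :=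
  (m : ℝ)⁻¹ • ∑ t ∈ Finset.range m, x (g t)

/-- The parallel axis identity: the deviations from the weighted mean `p` sum to zero, which kills
the cross terms. -/
theorem sum_weight_norm_sub_sq {S : Finset ι} {μ : ι → ℝ} {x : ι → E} {p : E}
    (h1 : ∑ i ∈ S, μ i = 1) (hp : ∑ i ∈ S, μ i • x i = p) (v : E) :
    ∑ i ∈ S, μ i * ‖x i - v‖ ^ 2 = ∑ i ∈ S, μ i * ‖x i - p‖ ^ 2 + ‖p - v‖ ^ 2 := by
  have h0 : ∑ i ∈ S, μ i * ⟪x i - p, p - v⟫_ℝ = 0 := by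
    have : ∑ i ∈ S, μ i • (x i - p) = 0 := by
      simp only [smul_sub, Finset.sum_sub_distrib, hp, ← Finset.sum_smul, h1, one_smul, sub_self]
    simpa [sum_inner, inner_smul_left] using congrArg (fun z => ⟪z, p - v⟫_ℝ) this
  have hi : ∀ i ∈ S, μ i * ‖x i - v‖ ^ 2 =
      μ i * ‖x i - p‖ ^ 2 + 2 * (μ i * ⟪x i - p, p - v⟫_ℝ) + μ i * ‖p - v‖ ^ 2 := by
    intro i _
    rw [← sub_add_sub_cancel (x i) p v, norm_add_sq_real]
    ring
  rw [Finset.sum_congr rfl hi, Finset.sum_add_distrib, Finset.sum_add_distrib, ← Finset.mul_sum,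
    h0, ← Finset.sum_mul, h1]
  ring

/-- Maurey's argument without probability: if the next point is averaged with weights `μ`, the
squared norm of the sum grows by exactly the variance, so some choice does no worse than the
average. -/
theorem exists_norm_sum_sub_sq_le {S : Finset ι} {μ : ι → ℝ} {x : ι → E} {p : E}
    (h0 : ∀ i ∈ S, 0 ≤ μ i) (h1 : ∑ i ∈ S, μ i = 1) (hp : ∑ i ∈ S, μ i • x i = p) (m : ℕ) :
    ∃ g : ℕ → ι, (∀ t, g t ∈ S) ∧
      ‖∑ t ∈ Finset.range m, (x (g t) - p)‖ ^ 2 ≤ m * ∑ i ∈ S, μ i * ‖x i - p‖ ^ 2 := by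
  induction m with
  | zero =>
    obtain ⟨i, hi⟩ : S.Nonempty := by
      rw [Finset.nonempty_iff_ne_empty]
      rintro rfl
      simp at h1
    exact ⟨fun _ => i, fun _ => hi, by simp⟩
  | succ m ih =>
    obtain ⟨g, hg, hle⟩ := ih
    set v := ∑ t ∈ Finset.range m, (x (g t) - p)
    set V := ∑ i ∈ S, μ i * ‖x i - p‖ ^ 2
    have key : ∃ i ∈ S, ‖v + (x i - p)‖ ^ 2 ≤ ‖v‖ ^ 2 + V := by
      by_contra! hcon
      -- The parallel axis identity at `p - v`, since `x i - (p - v) = v + (x i - p)`.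
      have hsum := sum_weight_norm_sub_sq h1 hp (p - v)
      have hzero : ∑ i ∈ S, μ i * (‖v + (x i - p)‖ ^ 2 - (‖v‖ ^ 2 + V)) = 0 := by
        have e : ∀ i, x i - (p - v) = v + (x i - p) := fun i => by abel
        simp only [e, sub_sub_cancel] at hsum
        simp only [mul_sub, Finset.sum_sub_distrib, ← Finset.sum_mul, h1, hsum]
        ring
      rw [Finset.sum_eq_zero_iff_of_nonneg fun i hi =>
        mul_nonneg (h0 i hi) (sub_nonneg.2 (hcon i hi).le)] at hzero
      have hμ : ∀ i ∈ S, μ i = 0 := fun i hi =>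
        (mul_eq_zero.1 (hzero i hi)).resolve_right (sub_ne_zero.2 (hcon i hi).ne')
      rw [Finset.sum_eq_zero hμ] at h1
      exact zero_ne_one h1
    obtain ⟨i, hi, hiv⟩ := key
    refine ⟨fun t => if t < m then g t else i, fun t => ?_, ?_⟩
    · dsimp only
      split_ifs
      · exact hg t
      · exact hi
    · rw [Finset.sum_range_succ, Finset.sum_congr rfl (g := fun t => x (g t) - p)
        fun t ht => by dsimp only; rw [if_pos (Finset.mem_range.1 ht)]]
      simp only [lt_irrefl, if_false]
      push_cast
      linarith

theorem exists_norm_sampleMean_sub_sq_le {S : Finset ι} {μ : ι → ℝ} {x : ι → E} {p : E}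
    (h0 : ∀ i ∈ S, 0 ≤ μ i) (h1 : ∑ i ∈ S, μ i = 1) (hp : ∑ i ∈ S, μ i • x i = p) {m : ℕ}
    (hm : 1 ≤ m) :
    ∃ g : ℕ → ι, (∀ t, g t ∈ S) ∧
      ‖sampleMean x m g - p‖ ^ 2 ≤ (m : ℝ)⁻¹ * ∑ i ∈ S, μ i * ‖x i - p‖ ^ 2 := by
  obtain ⟨g, hg, hle⟩ := exists_norm_sum_sub_sq_le h0 h1 hp m
  have hm0 : (0 : ℝ) < m := by exact_mod_cast hm
  refine ⟨g, hg, ?_⟩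
  have e : sampleMean x m g - p = (m : ℝ)⁻¹ • ∑ t ∈ Finset.range m, (x (g t) - p) := by
    rw [sampleMean, Finset.sum_sub_distrib, smul_sub, Finset.sum_const, Finset.card_range,
      ← Nat.cast_smul_eq_nsmul ℝ, smul_smul, inv_mul_cancel₀ hm0.ne', one_smul]
  rw [e, norm_smul, mul_pow, norm_inv, Real.norm_natCast]
  calc (m : ℝ)⁻¹ ^ 2 * ‖∑ t ∈ Finset.range m, (x (g t) - p)‖ ^ 2
      ≤ (m : ℝ)⁻¹ ^ 2 * (m * ∑ i ∈ S, μ i * ‖x i - p‖ ^ 2) := by gcongr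
    _ = _ := by field_simp

theorem one_le_sampleSize {ε : ℝ} (hε : 0 < ε) : 1 ≤ sampleSize ε :=
  Nat.ceil_pos.2 (by positivity)

theorem inv_sampleSize_le {ε : ℝ} (hε : 0 < ε) : (sampleSize ε : ℝ)⁻¹ ≤ ε ^ 2 := by
  have : 1 / (ε * ε) ≤ sampleSize ε := Nat.le_ceil _
  calc (sampleSize ε : ℝ)⁻¹ ≤ (1 / (ε * ε))⁻¹ := by gcongr
    _ = ε ^ 2 := by rw [one_div, inv_inv, sq]

/-- Sample around the centroid `p`. Replacing `p` by the sample mean adds `|S|` times their squared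
distance, at most a fraction `1 / m ≤ ε` of the optimal cost. -/
theorem exists_sampleMean_kMeans {S : Finset ι} (hS : S.Nonempty) (x : ι → E) (c : E) {ε : ℝ}
    (hε : 0 < ε) : ∃ g : ℕ → ι, (∀ t, g t ∈ S) ∧
      ∑ i ∈ S, ‖x i - sampleMean x (sampleSize ε) g‖ ^ 2 ≤ (1 + ε) * ∑ i ∈ S, ‖x i - c‖ ^ 2 := by
  have hN : (0 : ℝ) < S.card := by exact_mod_cast hS.card_pos
  set p := ∑ i ∈ S, (S.card : ℝ)⁻¹ • x i with hp
  have h1 : ∑ i ∈ S, (S.card : ℝ)⁻¹ = 1 := by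
    rw [Finset.sum_const, nsmul_eq_mul, mul_inv_cancel₀ hN.ne']
  obtain ⟨g, hg, hle⟩ := exists_norm_sampleMean_sub_sq_le (S := S) (x := x)
    (μ := fun _ => (S.card : ℝ)⁻¹) (fun i _ => by positivity) h1 hp.symm (one_le_sampleSize hε)
  have hv : ∀ v, ∑ i ∈ S, ‖x i - v‖ ^ 2 = ∑ i ∈ S, ‖x i - p‖ ^ 2 + S.card * ‖p - v‖ ^ 2 := by
    intro v
    have := sum_weight_norm_sub_sq h1 hp.symm v
    simp only [← Finset.mul_sum] at this
    field_simp at this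
    linarith
  rw [← Finset.mul_sum] at hle
  refine ⟨g, hg, ?_⟩
  rw [hv, hv c, norm_sub_rev p]
  set V := ∑ i ∈ S, ‖x i - p‖ ^ 2
  have hV : 0 ≤ V := Finset.sum_nonneg fun _ _ => sq_nonneg _
  -- For `ε ≤ 1` use `1 / m ≤ ε² ≤ ε`; for `ε ≥ 1` the bound `m ≥ 1` is enough.
  have hinv : (sampleSize ε : ℝ)⁻¹ ≤ ε := by
    rcases le_total ε 1 with h | h
    · exact (inv_sampleSize_le hε).trans (by nlinarith)
    · exact (inv_le_one_of_one_le₀ (by exact_mod_cast one_le_sampleSize hε)).trans h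
  clear hv h1
  clear_value V p
  have h2 : S.card * ‖sampleMean x (sampleSize ε) g - p‖ ^ 2 ≤ ε * V := by
    calc S.card * ‖sampleMean x (sampleSize ε) g - p‖ ^ 2
        ≤ S.card * ((sampleSize ε : ℝ)⁻¹ * ((S.card : ℝ)⁻¹ * V)) := by gcongr
      _ = (sampleSize ε : ℝ)⁻¹ * V := by field_simp
      _ ≤ ε * V := by gcongr
  have : 0 ≤ (1 + ε) * (S.card * ‖p - c‖ ^ 2) := by positivity
  linarith

/-- With weights proportional to `1 / ‖x i - c‖`, the second moment about `c` is `F / W`, so the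
variance about `p` is at most that. This yields both that `p` is no worse than `c` and that the
sample mean is close to `p`. -/
theorem exists_sampleMean_kMedian {S : Finset ι} (hS : S.Nonempty) (x : ι → E) (c : E) {ε : ℝ}
    (hε : 0 < ε) : ∃ g : ℕ → ι, (∀ t, g t ∈ S) ∧
      ∑ i ∈ S, ‖x i - sampleMean x (sampleSize ε) g‖ ≤ (1 + ε) * ∑ i ∈ S, ‖x i - c‖ := by
  have hN : (0 : ℝ) < S.card := by exact_mod_cast hS.card_pos
  have hm : (0 : ℝ) < sampleSize ε := by exact_mod_cast one_le_sampleSize hε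
  -- If `c` is itself a point of `S`, the weights are undefined, but the constant sample reproduces
  -- `c` exactly.
  by_cases hc : ∃ i ∈ S, x i = c
  · obtain ⟨i, hi, rfl⟩ := hc
    refine ⟨fun _ => i, fun _ => hi, ?_⟩
    have e : sampleMean x (sampleSize ε) (fun _ => i) = x i := by
      rw [sampleMean, Finset.sum_const, Finset.card_range, ← Nat.cast_smul_eq_nsmul ℝ, smul_smul,
        inv_mul_cancel₀ hm.ne', one_smul]
    rw [e]
    exact le_mul_of_one_le_left (Finset.sum_nonneg fun _ _ => norm_nonneg _) (by linarith)
  push Not at hc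
  have hr : ∀ i ∈ S, 0 < ‖x i - c‖ := fun i hi => norm_pos_iff.2 (sub_ne_zero.2 (hc i hi))
  set W := ∑ i ∈ S, ‖x i - c‖⁻¹ with hW
  set F := ∑ i ∈ S, ‖x i - c‖ with hF
  have hWpos : 0 < W := Finset.sum_pos (fun i hi => inv_pos.2 (hr i hi)) hS
  have hFpos : 0 < F := Finset.sum_pos hr hS
  set μ : ι → ℝ := fun i => ‖x i - c‖⁻¹ / W with hμ
  have h1 : ∑ i ∈ S, μ i = 1 := by
    rw [hμ, ← Finset.sum_div, div_self hWpos.ne']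
  set p := ∑ i ∈ S, μ i • x i with hp
  obtain ⟨g, hg, hle⟩ := exists_norm_sampleMean_sub_sq_le (S := S) (x := x) (μ := μ)
    (fun i hi => div_nonneg (inv_nonneg.2 (hr i hi).le) hWpos.le) h1 hp.symm
    (one_le_sampleSize hε)
  have hvar := sum_weight_norm_sub_sq h1 hp.symm c
  have hFW : ∑ i ∈ S, μ i * ‖x i - c‖ ^ 2 = F / W := by
    rw [hF, Finset.sum_div]
    refine Finset.sum_congr rfl fun i hi => ?_
    have := (hr i hi).ne'
    simp only [hμ]
    field_simp
  -- Cauchy–Schwarz; it turns the variance bound `F / W` into one on the total displacement of all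
  -- `|S|` points.
  have hCS : (S.card : ℝ) ^ 2 ≤ F * W := by
    have := Finset.sq_sum_div_le_sum_sq_div S (fun _ => (1 : ℝ)) hr
    simp only [Finset.sum_const, nsmul_eq_mul, mul_one, one_pow, one_div] at this
    rw [div_le_iff₀ hFpos] at this
    linarith
  rw [hFW] at hvar
  have hpF : ∑ i ∈ S, ‖x i - p‖ ≤ F := by
    -- AM–GM: `a ≤ a² / (2 r) + r / 2` with `a = ‖x i - p‖` and `r = ‖x i - c‖`. Both parts sum to
    -- at most `F / 2`.
    have hi : ∀ i ∈ S, ‖x i - p‖ ≤ W / 2 * (μ i * ‖x i - p‖ ^ 2) + ‖x i - c‖ / 2 := by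
      intro i hi
      have hri := hr i hi
      have e : W / 2 * (μ i * ‖x i - p‖ ^ 2) = ‖x i - p‖ ^ 2 / (2 * ‖x i - c‖) := by
        simp only [hμ]
        field_simp
      rw [e, div_add_div _ _ (by positivity) (by norm_num), le_div_iff₀ (by positivity)]
      nlinarith [sq_nonneg (‖x i - p‖ - ‖x i - c‖)]
    refine (Finset.sum_le_sum hi).trans ?_
    rw [Finset.sum_add_distrib, ← Finset.mul_sum, ← Finset.sum_div, ← hF]
    have : W / 2 * ∑ i ∈ S, μ i * ‖x i - p‖ ^ 2 ≤ W / 2 * (F / W) := by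
      gcongr
      nlinarith [sq_nonneg ‖p - c‖]
    have e : W / 2 * (F / W) = F / 2 := by field_simp
    linarith
  have hdist : S.card * ‖sampleMean x (sampleSize ε) g - p‖ ≤ ε * F := by
    refine le_of_sq_le_sq ?_ (by positivity)
    calc (S.card * ‖sampleMean x (sampleSize ε) g - p‖) ^ 2
        = S.card ^ 2 * ‖sampleMean x (sampleSize ε) g - p‖ ^ 2 := by ring
      _ ≤ S.card ^ 2 * ((sampleSize ε : ℝ)⁻¹ * (F / W)) := by
        refine mul_le_mul_of_nonneg_left (hle.trans ?_) (by positivity)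
        gcongr
        nlinarith [sq_nonneg ‖p - c‖]
      _ ≤ (F * W) * (ε ^ 2 * (F / W)) := by
        gcongr
        exact inv_sampleSize_le hε
      _ = (ε * F) ^ 2 := by field_simp
  refine ⟨g, hg, ?_⟩
  calc ∑ i ∈ S, ‖x i - sampleMean x (sampleSize ε) g‖
      ≤ ∑ i ∈ S, (‖x i - p‖ + ‖sampleMean x (sampleSize ε) g - p‖) := by
        refine Finset.sum_le_sum fun i _ => ?_
        rw [norm_sub_rev (sampleMean x (sampleSize ε) g) p]
        exact norm_sub_le_norm_sub_add_norm_sub _ _ _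
    _ = ∑ i ∈ S, ‖x i - p‖ + S.card * ‖sampleMean x (sampleSize ε) g - p‖ := by
        rw [Finset.sum_add_distrib, Finset.sum_const, nsmul_eq_mul]
    _ ≤ (1 + ε) * F := by linarith

/-- Projecting `c` to the convex hull does not increase the distance to any point, by the obtuse
angle criterion. The projection is a convex combination with variance at most `r²`, so the sample
mean is within `ε * r` of it. -/
theorem exists_sampleMean_kCenter {S : Finset ι} (hS : S.Nonempty) (x : ι → E) (c : E) {ε r : ℝ}
    (hε : 0 < ε) (hr : ∀ i ∈ S, ‖x i - c‖ ≤ r) : ∃ g : ℕ → ι, (∀ t, g t ∈ S) ∧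
      ∀ i ∈ S, ‖x i - sampleMean x (sampleSize ε) g‖ ≤ (1 + ε) * r := by
  classical
  have hr0 : 0 ≤ r := (norm_nonneg _).trans (hr _ hS.choose_spec)
  set K := convexHull ℝ ((S.image x : Finset E) : Set E) with hK
  have hKc : IsCompact K := (S.image x).finite_toSet.isCompact_convexHull ℝ
  have hsub : ∀ i ∈ S, x i ∈ K := fun i hi =>
    subset_convexHull ℝ _ (Finset.mem_coe.2 (Finset.mem_image_of_mem x hi))
  obtain ⟨p, hpK, hp⟩ := exists_norm_eq_iInf_of_complete_convex
    ⟨_, hsub _ hS.choose_spec⟩ hKc.isComplete (convex_convexHull ℝ _) c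
  rw [norm_eq_iInf_iff_real_inner_le_zero (convex_convexHull ℝ _) hpK] at hp
  have hpr : ∀ i ∈ S, ‖x i - p‖ ≤ r := by
    intro i hi
    refine le_trans (le_of_sq_le_sq ?_ (norm_nonneg _)) (hr i hi)
    have h1 := hp (x i) (hsub i hi)
    have h2 : ‖x i - c‖ ^ 2 = ‖x i - p‖ ^ 2 - 2 * ⟪x i - p, c - p⟫_ℝ + ‖c - p‖ ^ 2 := by
      rw [← norm_sub_sq_real, sub_sub_sub_cancel_right]
    rw [real_inner_comm] at h1
    nlinarith [sq_nonneg ‖c - p‖]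
  obtain ⟨μ, h0, h1, hμp⟩ := Finset.mem_convexHull'.1 hpK
  obtain ⟨g, hg, hle⟩ := exists_norm_sampleMean_sub_sq_le (x := id) h0 h1 hμp
    (one_le_sampleSize hε)
  -- The hull is spanned by the image of `S`, so the samples are points and have to be lifted to
  -- indices.
  choose g' hg' hgg' using fun t => Finset.mem_image.1 (hg t)
  have e : sampleMean x (sampleSize ε) g' = sampleMean id (sampleSize ε) g := by
    simp [sampleMean, hgg']
  have hV : ∑ y ∈ S.image x, μ y * ‖id y - p‖ ^ 2 ≤ r ^ 2 := by
    calc ∑ y ∈ S.image x, μ y * ‖id y - p‖ ^ 2 ≤ ∑ y ∈ S.image x, μ y * r ^ 2 := by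
          refine Finset.sum_le_sum fun y hy => mul_le_mul_of_nonneg_left ?_ (h0 y hy)
          obtain ⟨i, hi, rfl⟩ := Finset.mem_image.1 hy
          exact pow_le_pow_left₀ (norm_nonneg _) (hpr i hi) 2
      _ = r ^ 2 := by rw [← Finset.sum_mul, h1, one_mul]
  have hd : ‖sampleMean x (sampleSize ε) g' - p‖ ≤ ε * r := by
    refine le_of_sq_le_sq ?_ (by positivity)
    rw [e, mul_pow]
    exact hle.trans (mul_le_mul (inv_sampleSize_le hε) hV
      (Finset.sum_nonneg fun y hy => mul_nonneg (h0 y hy) (sq_nonneg _)) (sq_nonneg _))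
  refine ⟨g', hg', fun i hi => ?_⟩
  have := norm_sub_le_norm_sub_add_norm_sub (x i) p (sampleMean x (sampleSize ε) g')
  rw [norm_sub_rev p] at this
  linarith [hpr i hi]

end

/-! ### Costs of clusterings -/

theorem Objective.weight_norm_sq {E : Type*} [NormedAddCommGroup E] (obj : Objective) (v : E) :
    obj.weight (‖v‖ ^ 2) = match obj with
      | .kMeans => ‖v‖ ^ 2
      | _ => ‖v‖ := by
  cases obj <;> simp [weight, Real.sqrt_sq (norm_nonneg v)]

theorem Objective.total_eq_cost {n d : ℕ} (obj : Objective) (hn : 1 ≤ n)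
    (A C : Fin n → EuclideanSpace ℝ (Fin d)) {f : ℕ → ℝ}
    (hf : ∀ i : Fin n, f i = obj.weight (‖A i - C i‖ ^ 2)) : obj.total f n = obj.cost A C := by
  simp only [weight_norm_sq] at hf
  cases obj with
  | kMedian =>
    rw [total_eq_sum _ (by simp), ← Fin.sum_univ_eq_sum_range]
    exact Finset.sum_congr rfl fun i _ => hf i
  | kMeans =>
    rw [total_eq_sum _ (by simp), ← Fin.sum_univ_eq_sum_range]
    exact Finset.sum_congr rfl fun i _ => hf i
  | kCenter =>
    have : Nonempty (Fin n) := ⟨⟨0, hn⟩⟩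
    have hbdd : BddAbove (Set.range fun i => ‖A i - C i‖) := (Set.finite_range _).bddAbove
    have h0 : 0 ≤ Objective.kCenter.total f n :=
      Objective.kCenter.total_nonneg fun i hi => by rw [hf ⟨i, hi⟩]; exact norm_nonneg _
    refine le_antisymm ((total_kCenter_le_iff ?_).2 fun i hi => ?_) (ciSup_le fun i => ?_)
    · exact Real.iSup_nonneg fun i => norm_nonneg _
    · rw [hf ⟨i, hi⟩]
      exact le_ciSup hbdd ⟨i, hi⟩
    · exact (hf i).ge.trans ((total_kCenter_le_iff h0).1 le_rfl i i.2)

/-- Every clustering into `k` clusters has approximately optimal centers that are means of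
`sampleSize ε` points of the cluster. -/
theorem Objective.exists_cost_sampleMean_le {n d k : ℕ} (obj : Objective) (hn : 1 ≤ n)
    (A C : Fin n → EuclideanSpace ℝ (Fin d)) (τ : Fin n → Fin k)
    (hτ : ∀ i i', τ i = τ i' → C i = C i') {ε : ℝ} (hε : 0 < ε) :
    ∃ g : Fin k → ℕ → Fin n,
      obj.cost A (fun i => sampleMean A (sampleSize ε) (g (τ i))) ≤ (1 + ε) * obj.cost A C := by
  have : Nonempty (Fin n) := ⟨⟨0, hn⟩⟩
  have hC : ∀ j : Fin k, ∃ c, ∀ i, τ i = j → C i = c := by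
    intro j
    by_cases h : ∃ i, τ i = j
    · obtain ⟨i, rfl⟩ := h
      exact ⟨C i, fun i' hi' => hτ _ _ hi'⟩
    · exact ⟨0, fun i hi => absurd ⟨i, hi⟩ h⟩
  choose c hc using hC
  have sums : ∀ φ : EuclideanSpace ℝ (Fin d) → ℝ,
      (∀ S : Finset (Fin n), S.Nonempty → ∀ c, ∃ g : ℕ → Fin n, (∀ t, g t ∈ S) ∧
        ∑ i ∈ S, φ (A i - sampleMean A (sampleSize ε) g) ≤ (1 + ε) * ∑ i ∈ S, φ (A i - c)) →
      ∃ g : Fin k → ℕ → Fin n,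
        ∑ i, φ (A i - sampleMean A (sampleSize ε) (g (τ i))) ≤ (1 + ε) * ∑ i, φ (A i - C i) := by
    intro φ hφ
    have : ∀ j : Fin k, ∃ g : ℕ → Fin n,
        ∑ i with τ i = j, φ (A i - sampleMean A (sampleSize ε) g) ≤
          (1 + ε) * ∑ i with τ i = j, φ (A i - C i) := by
      intro j
      have e : ∑ i with τ i = j, φ (A i - C i) = ∑ i with τ i = j, φ (A i - c j) :=
        Finset.sum_congr rfl fun i hi => by rw [hc j i (Finset.mem_filter.1 hi).2]
      rw [e]
      rcases (Finset.univ.filter fun i => τ i = j).eq_empty_or_nonempty with h | h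
      · exact ⟨fun _ => Classical.arbitrary _, by simp [h]⟩
      · obtain ⟨g, -, hg⟩ := hφ _ h (c j)
        exact ⟨g, hg⟩
    choose g hg using this
    refine ⟨g, ?_⟩
    rw [← Finset.sum_fiberwise _ τ, ← Finset.sum_fiberwise _ τ fun i => φ (A i - C i),
      Finset.mul_sum]
    refine Finset.sum_le_sum fun j _ => le_trans (le_of_eq ?_) (hg j)
    exact Finset.sum_congr rfl fun i hi => by rw [(Finset.mem_filter.1 hi).2]
  cases obj with
  | kMedian => exact sums (fun v => ‖v‖) fun S hS c => exists_sampleMean_kMedian hS A c hε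
  | kMeans => exact sums (fun v => ‖v‖ ^ 2) fun S hS c => exists_sampleMean_kMeans hS A c hε
  | kCenter =>
    have hbdd : BddAbove (Set.range fun i => ‖A i - C i‖) := (Set.finite_range _).bddAbove
    have : ∀ j : Fin k, ∃ g : ℕ → Fin n, ∀ i, τ i = j →
        ‖A i - sampleMean A (sampleSize ε) g‖ ≤ (1 + ε) * ⨆ i, ‖A i - C i‖ := by
      intro j
      rcases (Finset.univ.filter fun i => τ i = j).eq_empty_or_nonempty with h | h
      · exact ⟨fun _ => Classical.arbitrary _, fun i hi => absurd hi
          (Finset.filter_eq_empty_iff.1 h (Finset.mem_univ i))⟩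
      · obtain ⟨g, -, hg⟩ := exists_sampleMean_kCenter h A (c j) hε
          (r := ⨆ i, ‖A i - C i‖) fun i hi => by
            rw [← hc j i (Finset.mem_filter.1 hi).2]
            exact le_ciSup hbdd i
        exact ⟨g, fun i hi => hg i (by simp [hi])⟩
    choose g hg using this
    exact ⟨g, ciSup_le fun i => hg _ i rfl⟩

/-! ### Codes of colour classes -/

section

variable {n ℓ k : ℕ} (c : Fin n → Fin ℓ)

/-- The number of points of colour `a` that are assigned to the center `j`. -/
def colourCount (τ : Fin n → Fin k) (a : Fin ℓ) (j : Fin k) : Fin (n + 1) :=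
  ⟨(Finset.univ.filter fun i => c i = a ∧ τ i = j).card,
    Nat.lt_succ_of_le ((Finset.card_le_univ _).trans (Fintype.card_fin n).le)⟩

/-- Grouping the points by center shows that the code has base `n + 1` digits `colourCount c τ a`.
Counts are at most `n`, so no carries occur and equal codes mean equal counts. -/
theorem classCode_eq {col : ℕ → ℕ} (hcol : ∀ i : Fin n, col i = c i) (τ : Fin n → Fin k)
    {τ' : ℕ → ℕ} (hτ : ∀ i : Fin n, τ' i = τ i) (a : Fin ℓ) :
    classCode col (fun j => (n + 1) ^ j) a τ' n = finFunctionFinEquiv (colourCount c τ a) := by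
  have h1 : ∀ (b : ℕ → ℕ) (N : ℕ), classCode col b a τ' N =
      ∑ i ∈ Finset.range N, if col i = a then b (τ' i) else 0 := by
    intro b N
    induction N with
    | zero => rfl
    | succ N ih => rw [Finset.sum_range_succ, ← ih]; rfl
  rw [h1, ← Fin.sum_univ_eq_sum_range (fun i => if col i = a then (n + 1) ^ (τ' i) else 0),
    finFunctionFinEquiv_apply, ← Finset.sum_fiberwise _ τ]
  refine Finset.sum_congr rfl fun j _ => ?_
  simp only [colourCount, hcol, hτ, Fin.val_inj]
  rw [← Finset.sum_filter, Finset.filter_filter, ← smul_eq_mul, ← Finset.sum_const]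
  refine Finset.sum_congr (by ext i; simp [and_comm]) fun i hi => ?_
  rw [(Finset.mem_filter.1 hi).2.2]

/-- A general predicate `p` on centers is needed because differently numbered centers may coincide;
a cluster is then a union of several fibres of `τ`. -/
theorem card_filter_eq_sum_colourCount (τ : Fin n → Fin k) (a : Fin ℓ) (p : Fin k → Prop)
    [DecidablePred p] :
    ((Finset.univ.filter fun i => p (τ i)).filter fun i => c i = a).card =
      ∑ j with p j, (colourCount c τ a j : ℕ) := by
  rw [Finset.card_eq_sum_card_fiberwise (f := τ) (t := Finset.univ.filter p)]
  · refine Finset.sum_congr rfl fun j hj => ?_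
    simp only [colourCount]
    congr 1
    ext i
    simp only [Finset.mem_filter, Finset.mem_univ, true_and] at hj ⊢
    constructor
    · rintro ⟨⟨-, h1⟩, h2⟩
      exact ⟨h1, h2⟩
    · rintro ⟨h1, rfl⟩
      exact ⟨⟨hj, h1⟩, rfl⟩
  · intro i hi
    simpa using (Finset.mem_filter.1 (Finset.mem_filter.1 (Finset.mem_coe.1 hi)).1).2

theorem isFairClustering_of_code {d : ℕ} {col : ℕ → ℕ} (hcol : ∀ i : Fin n, col i = c i) {r : ℕ}
    {σ : ℕ → ℕ} (hσ : ValidAssignment n ℓ k col r σ) (y : ℕ → EuclideanSpace ℝ (Fin d)) :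
    IsFairClustering k c fun i : Fin n => y (σ i) := by
  classical
  set τ : Fin n → Fin k := fun i => ⟨σ i, hσ.1 i i.2⟩ with hτ
  have hcount : ∀ a b, colourCount c τ a = colourCount c τ b := by
    intro a b
    apply finFunctionFinEquiv.injective
    apply Fin.ext
    rw [← classCode_eq c hcol τ (fun _ => rfl) a, ← classCode_eq c hcol τ (fun _ => rfl) b,
      hσ.2 a a.2, hσ.2 b b.2]
  refine ⟨?_, fun i0 a b => ?_⟩
  · calc _ ≤ (Finset.univ.image fun j : Fin k => y j).card := by
          refine Finset.card_le_card fun v hv => ?_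
          obtain ⟨i, -, rfl⟩ := Finset.mem_image.1 hv
          exact Finset.mem_image.2 ⟨τ i, Finset.mem_univ _, rfl⟩
      _ ≤ k := Finset.card_image_le.trans (by simp)
  · have := fun a => card_filter_eq_sum_colourCount c τ a (fun j => y j = y (σ i0))
    exact (this a).trans ((by rw [hcount a b] : _ = _).trans (this b).symm)

/-- Number the distinct rows of `C` by elements of `Fin k`. Each used number is one cluster,
balanced by hypothesis; unused numbers have count `0` for every colour. -/
theorem IsFairClustering.exists_assignment {d : ℕ} {C : Fin n → EuclideanSpace ℝ (Fin d)}
    (hC : IsFairClustering k c C) :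
    ∃ τ : Fin n → Fin k, (∀ i i', τ i = τ i' ↔ C i = C i') ∧
      ∀ a b, colourCount c τ a = colourCount c τ b := by
  classical
  obtain ⟨h1, h2⟩ := hC
  have hmem : ∀ i, C i ∈ Finset.univ.image C := fun i =>
    Finset.mem_image_of_mem C (Finset.mem_univ i)
  have hcard : (Finset.univ.image C).card ≤ k := by convert h1
  set τ : Fin n → Fin k := fun i => Fin.castLE hcard ((Finset.univ.image C).equivFin ⟨C i, hmem i⟩)
  have hτ : ∀ i i', τ i = τ i' ↔ C i = C i' := by
    intro i i'
    simp only [τ, (Fin.castLE_injective hcard).eq_iff, Equiv.apply_eq_iff_eq, Subtype.mk.injEq]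
  refine ⟨τ, hτ, fun a b => funext fun j => Fin.ext ?_⟩
  simp only [colourCount]
  by_cases hj : ∃ i, τ i = j
  · obtain ⟨i, rfl⟩ := hj
    have := h2 i a b
    rw [Finset.filter_filter, Finset.filter_filter] at this
    convert this using 3 <;> simp only [hτ, and_comm]
  · have : ∀ a : Fin ℓ, (Finset.univ.filter fun i => c i = a ∧ τ i = j) = ∅ := by
      intro a
      rw [Finset.filter_eq_empty_iff]
      exact fun i _ h => hj ⟨i, h.2⟩
    rw [this, this]

end

/-- The guess is `r + (n + 1) ^ k * y`, where `y` has the base `n` digits `g j t` at positions `j *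
m + t`. Every code and every tuple of samples is thus tried. -/
theorem exists_guess {n k m r : ℕ} (hr : r < (n + 1) ^ k) (g : Fin k → ℕ → Fin n) :
    ∃ x < (n + 1) ^ k * n ^ (k * m), guessCode n k x = r ∧
      ∀ j : Fin k, ∀ t < m, guessDigit n k x (j * m + t) = g j t := by
  set D : Fin (k * m) → Fin n := fun u => g u.divNat u.modNat
  set y := finFunctionFinEquiv D with hy
  refine ⟨r + (n + 1) ^ k * y, ?_, ?_, fun j t ht => ?_⟩
  · calc r + (n + 1) ^ k * y < (n + 1) ^ k * (y + 1) := by rw [mul_add, mul_one]; omega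
      _ ≤ _ := Nat.mul_le_mul_left _ y.2
  · rw [guessCode, Nat.add_mul_mod_self_left, Nat.mod_eq_of_lt hr]
  · have hu : j * m + t < k * m := by
      have : (j + 1) * m ≤ k * m := Nat.mul_le_mul_right _ j.2
      rw [add_mul, one_mul] at this
      omega
    have h1 : (r + (n + 1) ^ k * y) / (n + 1) ^ k = y := by
      rw [Nat.add_mul_div_left _ _ (by positivity), Nat.div_eq_of_lt hr, zero_add]
    have h2 : finFunctionFinEquiv.symm y ⟨j * m + t, hu⟩ = D ⟨j * m + t, hu⟩ := by
      rw [hy, Equiv.symm_apply_apply]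
    have h3 : (y : ℕ) / n ^ (j * m + t) % n = D ⟨j * m + t, hu⟩ := congrArg Fin.val h2
    rw [guessDigit, h1, h3]
    have hdiv : (⟨j * m + t, hu⟩ : Fin (k * m)).divNat = j := by
      apply Fin.ext
      simp only [Fin.coe_divNat]
      rw [mul_comm, Nat.mul_add_div (by omega), Nat.div_eq_of_lt ht, add_zero]
    have hmod : ((⟨j * m + t, hu⟩ : Fin (k * m)).modNat : ℕ) = t := by
      simp only [Fin.coe_modNat]
      rw [mul_comm, Nat.mul_add_mod, Nat.mod_eq_of_lt ht]
    simp only [D, hdiv, hmod]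

/-! ### Correctness of the program -/

section

variable {n d ℓ k : ℕ} {A : Fin n → EuclideanSpace ℝ (Fin d)} {c : Fin n → Fin ℓ} {ε : ℝ}

theorem inputMemory_real_one (i : Fin n) (e : Fin d) :
    (inputMemory A c k ε).real 1 (i * d + e) = A i e := by
  have hd : 0 < d := e.pos
  have hdiv : (i * d + e : ℕ) / d = i := by
    rw [mul_comm, Nat.mul_add_div hd, Nat.div_eq_of_lt e.2, add_zero]
  have hmod : (i * d + e : ℕ) % d = e := by
    rw [mul_comm, Nat.mul_add_mod, Nat.mod_eq_of_lt e.2]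
  simp [inputMemory, hdiv, hmod]

theorem inputMemory_nat_one (i : Fin n) : (inputMemory A c k ε).nat 1 i = c i := by
  simp [inputMemory]

/-- The center `j` for the sampled points `dig`. -/
noncomputable def meanCenter (X : ℕ → ℝ) (d m : ℕ) (dig : ℕ → ℕ) (j : ℕ) :
    EuclideanSpace ℝ (Fin d) :=
  WithLp.toLp 2 fun e => meanCoord X d m dig j e

theorem guessCost_eq_cost (obj : Objective) (hn : 1 ≤ n) (m x : ℕ) (τ : ℕ → ℕ) :
    guessCost obj ((inputMemory A c k ε).real 1) n d k m x τ =
      obj.cost A fun i => meanCenter ((inputMemory A c k ε).real 1) d m (guessDigit n k x) (τ i) := by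
  refine obj.total_eq_cost hn _ _ fun i => ?_
  rw [pointWeight, EuclideanSpace.real_norm_sq_eq, ← Fin.sum_univ_eq_sum_range
    (fun e => ((inputMemory A c k ε).real 1 (i * d + e) -
      meanCoord ((inputMemory A c k ε).real 1) d m (guessDigit n k x) (τ i) e) ^ 2)]
  simp only [inputMemory_real_one]
  rfl

theorem meanCenter_eq_sampleMean {m : ℕ} {dig : ℕ → ℕ} {g : ℕ → Fin n} {j : ℕ}
    (h : ∀ t < m, dig (j * m + t) = g t) :
    meanCenter ((inputMemory A c k ε).real 1) d m dig j = sampleMean A m g := by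
  ext e
  simp only [meanCenter, meanCoord, sampleMean, PiLp.smul_apply, smul_eq_mul, WithLp.ofLp_sum,
    Finset.sum_apply]
  rw [div_eq_inv_mul]
  congr 1
  refine Finset.sum_congr rfl fun t ht => ?_
  rw [h t (Finset.mem_range.1 ht), inputMemory_real_one]

/-- The cluster of the first point contains a point of its own colour, hence by balance one of every
colour. This justifies giving up when `n < ℓ`, and otherwise bounds the loop over colours. -/
theorem IsFairClustering.l_le {C : Fin n → EuclideanSpace ℝ (Fin d)}
    (hC : IsFairClustering k c C) (hn : 1 ≤ n) : ℓ ≤ n := by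
  classical
  have hsurj : Function.Surjective c := by
    intro a
    by_contra hcon
    push Not at hcon
    have h := hC.2 ⟨0, hn⟩ a (c ⟨0, hn⟩)
    rw [Finset.card_eq_zero.2 (Finset.filter_eq_empty_iff.2 fun i _ => hcon i)] at h
    have hmem := Finset.filter_eq_empty_iff.1 (Finset.card_eq_zero.1 h.symm)
      (x := ⟨0, hn⟩) (by simp)
    exact hmem rfl
  simpa using Fintype.card_le_of_surjective c hsurj

theorem Objective.cost_nonneg (obj : Objective) (A C : Fin n → EuclideanSpace ℝ (Fin d)) :
    0 ≤ obj.cost A C := by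
  cases obj
  · exact Finset.sum_nonneg fun _ _ => norm_nonneg _
  · exact Finset.sum_nonneg fun _ _ => sq_nonneg _
  · exact Real.iSup_nonneg fun _ => norm_nonneg _

theorem Objective.cost_self (obj : Objective) (A : Fin n → EuclideanSpace ℝ (Fin d)) :
    obj.cost A A = 0 := by
  cases obj <;> simp [cost]

/-- For a single point, fairness does not depend on the center. -/
theorem isFairClustering_one (hk : 1 ≤ k) {c : Fin 1 → Fin ℓ}
    {C : Fin 1 → EuclideanSpace ℝ (Fin d)} (hC : IsFairClustering k c C)
    (C' : Fin 1 → EuclideanSpace ℝ (Fin d)) : IsFairClustering k c C' := by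
  refine ⟨Finset.card_image_le.trans (by simpa using hk), fun j => ?_⟩
  have := hC.2 j
  simp only [Subsingleton.elim _ j, Finset.filter_true] at this ⊢
  exact this

/-- The program finds an approximately optimal fair clustering, provided that `Y` bounds the
numbers of rounds of its loops. -/
theorem runs_clusterProg (obj : Objective) {Y : ℕ} (hε : 0 < ε) (hk : 1 ≤ k) (hn : 1 ≤ n)
    (hY : 2 ≤ n → n ≤ Y ∧ k ≤ Y ∧ sampleSize ε ≤ Y ∧ (n + 1) ^ k ≤ Y ∧
      (n + 1) ^ k * n ^ (k * sampleSize ε) ≤ Y ∧ k * sampleSize ε ≤ Y ∧ n * k ≤ Y ∧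
      n * (n + 1) ^ k ≤ Y) :
    Runs Y d (clusterProg obj) (inputMemory A c k ε) fun s =>
      ∀ C' : Fin n → EuclideanSpace ℝ (Fin d), IsFairClustering k c C' →
        IsFairClustering k c (outputMatrix n d s) ∧
          obj.cost A (outputMatrix n d s) ≤ (1 + ε) * obj.cost A C' := by
  have hn0 : (inputMemory A c k ε).nat 0 0 = n := rfl
  have hd0 : (inputMemory A c k ε).nat 0 1 = d := rfl
  have hl0 : (inputMemory A c k ε).nat 0 2 = ℓ := rfl
  have hk0 : (inputMemory A c k ε).nat 0 3 = k := rfl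
  have hcol : ∀ i : Fin n, (inputMemory A c k ε).nat 1 i = c i := inputMemory_nat_one
  refine .ite (fun hn2 => .ite (fun hl => .skip fun C' hC' => ?_) fun hl => ?_) (fun hn2 => ?_)
  · exact absurd (hC'.l_le hn) (not_le.2 hl)
  · obtain ⟨b1, b2, b3, b4, b5, b6, b7, b8⟩ := hY hn2
    refine .comp (runs_setupProg hε rfl hn0 hd0 hl0 hk0 rfl rfl hn hk (not_lt.1 hl)
      b1 b2 b3 b4 b5 b6 b7 b8) fun s1 _ r1 => ?_
    refine (runs_searchProg r1 fun i hi => by rw [hcol ⟨i, hi⟩]; exact (c ⟨i, hi⟩).2).mono ?_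
    intro s2 _ h2 C' hC'
    obtain ⟨τ, hτ, hcount⟩ := hC'.exists_assignment
    obtain ⟨g, hg⟩ := obj.exists_cost_sampleMean_le hn A C' τ (fun i i' => (hτ i i').1) hε
    -- All colours share one count vector, so the colour of the first point can serve as reference.
    set a0 : Fin ℓ := c ⟨0, hn⟩
    set r : Fin ((n + 1) ^ k) := finFunctionFinEquiv (colourCount c τ a0)
    obtain ⟨x, hx, hxr, hxg⟩ := exists_guess (m := sampleSize ε) r.2 g
    set τ' : ℕ → ℕ := fun i => if h : i < n then τ ⟨i, h⟩ else 0
    have hτ' : ∀ i : Fin n, τ' i = τ i := fun i => by simp [τ']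
    have hvalid : ValidAssignment n ℓ k ((inputMemory A c k ε).nat 1) (guessCode n k x) τ' := by
      refine ⟨fun i hi => ?_, fun a ha => ?_⟩
      · rw [hτ' ⟨i, hi⟩]
        exact (τ ⟨i, hi⟩).2
      · rw [classCode_eq c hcol τ hτ' ⟨a, ha⟩, hcount ⟨a, ha⟩ a0, hxr]
    rcases h2 with h2 | ⟨x', σ, v1, v2, v3, v4⟩
    · exact absurd hvalid (h2 x hx τ')
    have hout : outputMatrix n d s2 = fun i : Fin n =>
        meanCenter ((inputMemory A c k ε).real 1) d (sampleSize ε) (guessDigit n k x') (σ i) := by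
      funext i
      ext e
      exact v3 i i.2 e e.2
    rw [hout]
    refine ⟨isFairClustering_of_code c hcol v1 _, ?_⟩
    rw [← guessCost_eq_cost obj hn, ← v2]
    refine (v4 x hx τ' hvalid).trans (le_trans (le_of_eq ?_) hg)
    rw [guessCost_eq_cost obj hn]
    congr 1
    funext i
    rw [hτ']
    exact meanCenter_eq_sampleMean (hxg (τ i))
  · have hn1 : n = 1 := by
      have : ¬ 1 < n := hn2
      omega
    subst hn1
    refine (runs_copyProg hd0).mono fun s1 _ h1 C' hC' => ?_
    have hout : outputMatrix 1 d s1 = A := by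
      funext i
      ext e
      have := inputMemory_real_one (A := A) (c := c) (k := k) (ε := ε) i e
      obtain rfl : i = 0 := Subsingleton.elim _ _
      rw [← this]
      simpa [outputMatrix] using h1 e e.2
    rw [hout]
    refine ⟨isFairClustering_one hk hC' A, ?_⟩
    rw [obj.cost_self]
    exact mul_nonneg (by linarith) (obj.cost_nonneg A C')

/-- A bound for the numbers of rounds of all loops of the program. -/
theorem loop_bounds {m : ℕ} (hk : 1 ≤ k) (hn : 2 ≤ n) :
    n ≤ n ^ (2 * k + k * m + 1) ∧ k ≤ n ^ (2 * k + k * m + 1) ∧ m ≤ n ^ (2 * k + k * m + 1) ∧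
      (n + 1) ^ k ≤ n ^ (2 * k + k * m + 1) ∧
      (n + 1) ^ k * n ^ (k * m) ≤ n ^ (2 * k + k * m + 1) ∧ k * m ≤ n ^ (2 * k + k * m + 1) ∧
      n * k ≤ n ^ (2 * k + k * m + 1) ∧ n * (n + 1) ^ k ≤ n ^ (2 * k + k * m + 1) := by
  have mono : ∀ {a : ℕ}, a ≤ 2 * k + k * m + 1 → n ^ a ≤ n ^ (2 * k + k * m + 1) :=
    fun h => Nat.pow_le_pow_right (by omega) h
  have self_le : ∀ a : ℕ, a ≤ n ^ a := fun a => (Nat.lt_pow_self hn).le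
  have hkm : m ≤ k * m := Nat.le_mul_of_pos_left m hk
  -- Uses `n + 1 ≤ n ^ 2`, which is where `n ≥ 2` matters.
  have hR : (n + 1) ^ k ≤ n ^ (2 * k) := by
    rw [pow_mul]
    exact Nat.pow_le_pow_left (by nlinarith) k
  refine ⟨?_, (self_le k).trans (mono (by omega)), (self_le m).trans (mono (by omega)),
    hR.trans (mono (by omega)), ?_, (self_le _).trans (mono (by omega)), ?_, ?_⟩
  · simpa using mono (a := 1) (by omega)
  · calc (n + 1) ^ k * n ^ (k * m) ≤ n ^ (2 * k) * n ^ (k * m) := Nat.mul_le_mul_right _ hR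
      _ = n ^ (2 * k + k * m) := (pow_add _ _ _).symm
      _ ≤ _ := mono (by omega)
  · calc n * k ≤ n * n ^ k := Nat.mul_le_mul_left _ (self_le k)
      _ = n ^ (k + 1) := (pow_succ' _ _).symm
      _ ≤ _ := mono (by omega)
  · calc n * (n + 1) ^ k ≤ n * n ^ (2 * k) := Nat.mul_le_mul_left _ hR
      _ = n ^ (2 * k + 1) := (pow_succ' _ _).symm
      _ ≤ _ := mono (by omega)

/-- The exponent of the running time is polynomial in `k / min ε 1`. -/
theorem exponent_le (hε : 0 < ε) (hk : 1 ≤ k) :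
    ((4 * (2 * k + k * sampleSize ε + 1) : ℕ) : ℝ) ≤
      (8 * Polynomial.X ^ 3 + 12 * Polynomial.X : Polynomial ℝ).eval ((k : ℝ) / min ε 1) := by
  have hδ : 0 < min ε 1 := lt_min hε one_pos
  have hk1 : (1 : ℝ) ≤ k := by exact_mod_cast hk
  set y := (k : ℝ) / min ε 1 with hy
  have hky : (k : ℝ) ≤ y := by
    rw [hy, le_div_iff₀ hδ]
    exact mul_le_of_le_one_right (by linarith) (min_le_right _ _)
  have hεy : 1 / ε ≤ y := by
    rw [hy]
    exact div_le_div₀ (by linarith) hk1 hδ (min_le_left _ _)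
  have hm : (sampleSize ε : ℝ) ≤ 2 * y ^ 2 := by
    have h1 : (sampleSize ε : ℝ) < 1 / (ε * ε) + 1 := Nat.ceil_lt_add_one (by positivity)
    have h2 : 1 / (ε * ε) = (1 / ε) ^ 2 := by field_simp
    have h3 : (1 / ε) ^ 2 ≤ y ^ 2 := by gcongr
    nlinarith
  have hkm : (k : ℝ) * sampleSize ε ≤ y * (2 * y ^ 2) :=
    mul_le_mul hky hm (Nat.cast_nonneg _) (by linarith)
  push_cast
  simp only [Polynomial.eval_add, Polynomial.eval_mul, Polynomial.eval_pow, Polynomial.eval_X,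
    Polynomial.eval_ofNat]
  -- With `y ≥ k ≥ 1`: `8 * k ≤ 8 * y`, `4 * k * m ≤ 8 * y ^ 3` and `4 ≤ 4 * y`.
  nlinarith

end

end FairClustering

theorem mainTheorem6 (obj : FairClustering.Objective) :
    ∃ (prog : FairClustering.Program) (p : Polynomial ℝ) (K : ℝ),
      ∀ (k : ℕ) (ε : ℝ), 1 ≤ k → 0 < ε →
      ∀ (n d ℓ : ℕ) (A : Fin n → EuclideanSpace ℝ (Fin d)) (c : Fin n → Fin ℓ), 1 ≤ n →
      ∃ (s : FairClustering.Memory) (t : ℕ),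
        FairClustering.Exec prog (FairClustering.inputMemory A c k ε) s t ∧
        (t : ℝ) ≤ K * (d + 1) * (n : ℝ) ^ p.eval ((k : ℝ) / min ε 1) ∧
        ∀ C' : Fin n → EuclideanSpace ℝ (Fin d), FairClustering.IsFairClustering k c C' →
          FairClustering.IsFairClustering k c (FairClustering.outputMatrix n d s) ∧
          obj.cost A (FairClustering.outputMatrix n d s) ≤ (1 + ε) * obj.cost A C' := by
  open FairClustering in
  refine ⟨clusterProg obj, 8 * Polynomial.X ^ 3 + 12 * Polynomial.X, (clusterProg obj).coeff, ?_⟩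
  intro k ε hk hε n d ℓ A c hn
  obtain ⟨s, t, he, ht, hs⟩ := runs_clusterProg (A := A) (c := c)
    (Y := n ^ (2 * k + k * sampleSize ε + 1)) obj hε hk hn
    (loop_bounds hk)
  refine ⟨s, t, he, ?_, hs⟩
  have hn1 : (1 : ℝ) ≤ n := by exact_mod_cast hn
  have h := ht.trans (Program.cost_le (Nat.one_le_pow _ _ hn) _)
  rw [clusterProg_dimDepth, clusterProg_depth, pow_one, ← pow_mul, mul_comm _ 4] at h
  calc (t : ℝ) ≤ (clusterProg obj).coeff * (d + 1) *
        (n : ℝ) ^ (4 * (2 * k + k * sampleSize ε + 1)) := by exact_mod_cast h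
    _ = (clusterProg obj).coeff * (d + 1) *
        (n : ℝ) ^ ((4 * (2 * k + k * sampleSize ε + 1) : ℕ) : ℝ) := by rw [Real.rpow_natCast]
    _ ≤ _ := by
      gcongr
      exact exponent_le hε hk
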